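/- \textbf{Model.} A single server serves jobs in first-come-first-served order. Jobs arrive as a Poisson process of rate $\lambda>0$; service times are independent and exponential with rate $\mu f$, where $\mu>0$ is the maximal service rate, $f$ is the frequency factor, and $\lambda<\mu f$. There are $n\ge 1$ low-power states $(P_i,\tau_i,w_i)$, $1\le i\le n$, with $0\le\tau_1<\dots<\tau_n$. State $i$ draws power $P_i$ and is entered $\tau_i$ seconds after the queue has emptied, provided no job has arrived since; until time $\tau_1$ after emptying the server stays in the active state. A job that arrives at an empty system while the server is in low-power state $i$ immediately triggers a wake-up, during which no job can be served; its duration is a non-negative random variable with mean $w_i<\infty$ whose law depends only on $i$. No wake-up is needed if the server is still in the active state. Inter-arrival times, service times and wake-up latencies are mutually independent. The server draws power $P_0$ in the active state (whether serving or empty) and during wake-up. The queue has just emptied at time $0$. Let $P(t)$ be the power drawn at time $t$. \textbf{Claim.} Put $$L=\frac{\mu f+\mu f\lambda\left[\sum_{i=1}^{n-1}w_i\left(e^{-\lambda\tau_i}-e^{-\lambda\tau_{i+1}}\right)+w_ne^{-\lambda\tau_n}\right]}{\lambda(\mu f-\lambda)}.$$ Then the queue almost surely empties again after the first arrival, and the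 expected length of the cycle between two consecutive times at which the queue empties, here the cycle starting at time $0$, is finite and equal to $L$. Moreover the long-run average power is $$\mathbb{E}[P]=\frac{1}{\lambda L}\left[\sum_{i=1}^{n-1}P_i\left(e^{-\lambda\tau_i}-e^{-\lambda\tau_{i+1}}\right)+P_ne^{-\lambda\tau_n}\right]+P_0\left(1-\frac{e^{-\lambda\tau_1}}{\lambda L}\right),$$ that is, as $T\to\infty$, $\frac1T\int_0^TP(t)\,dt$ converges to this value almost surely, and so does its expectation $\mathbb{E}\left[\frac1T\int_0^TP(t)\,dt\right]$. -/

import Mathlib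

open MeasureTheory ProbabilityTheory Filter Topology

noncomputable section

namespace SleepServer

open Classical in
/-- The power state of a server whose queue emptied `s` seconds ago and which has had no arrival
since: the largest `i` with `1 ≤ i ≤ n` and `τ i ≤ s`, and `0` (still in the active state) if
there is no such `i`. -/
def idleState (n : ℕ) (τ : ℕ → ℝ) (s : ℝ) : ℕ := Nat.findGreatest (fun i => τ i ≤ s) n

/-- Arrival time of job `k` (jobs are numbered `0, 1, 2, …`), where `X 0` is the time until the
first arrival and `X k` is the time between the arrivals of jobs `k - 1` and `k`. -/
def arrival (X : ℕ → ℝ) (k : ℕ) : ℝ := ∑ j ∈ Finset.range (k + 1), X j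

/-- The wake-up latency met by a job that arrives `s` seconds after the queue emptied, if waking up
from state `i` takes time `W i`. A server that is still in the active state needs no wake-up. -/
def wakeUp (n : ℕ) (τ : ℕ → ℝ) (W : ℕ → ℝ) (s : ℝ) : ℝ :=
  if idleState n τ s = 0 then 0 else W (idleState n τ s)

/-- `cleared n τ X S W k` is the time at which the first `k` jobs have all been completed, under
first-come-first-served service. The queue has just emptied at time `0`. A job that arrives before
all its predecessors have left is served right after them; any other job triggers the wake-up from
the state the server is in, and is served when the wake-up is over. Here `S k` is the service time
of job `k`, and `W i k` is the wake-up latency incurred if job `k` finds the server in low-power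
state `i`. -/
def cleared (n : ℕ) (τ : ℕ → ℝ) (X S : ℕ → ℝ) (W : ℕ → ℕ → ℝ) : ℕ → ℝ
  | 0 => 0
  | k + 1 =>
    if arrival X k < cleared n τ X S W k then
      cleared n τ X S W k + S k
    else
      arrival X k
        + wakeUp n τ (fun i => W i k) (arrival X k - cleared n τ X S W k) + S k

open Classical in
/-- The power drawn at time `t`. The system is empty at time `t` exactly if, for some `k`, the
first `k` jobs are completed by time `t` and job `k` arrives after time `t`; then the power is that
of the state reached after the elapsed idle time. At all other times (service or wake-up) the power
is the active power `P 0`. -/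
def power (n : ℕ) (P τ : ℕ → ℝ) (X S : ℕ → ℝ) (W : ℕ → ℕ → ℝ) (t : ℝ) : ℝ :=
  if h : ∃ k, cleared n τ X S W k ≤ t ∧ t < arrival X k then
    P (idleState n τ (t - cleared n τ X S W (Nat.find h)))
  else P 0

/-- The indices `k ≥ 1` such that the system is empty when job `k` arrives. -/
def findsEmpty (n : ℕ) (τ : ℕ → ℝ) (X S : ℕ → ℝ) (W : ℕ → ℕ → ℝ) : Set ℕ :=
  {k | 1 ≤ k ∧ cleared n τ X S W k ≤ arrival X k}

/-- The length of the cycle that starts at time `0`, when the queue has just emptied: the next time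
at which the queue empties. (Meaningful if `findsEmpty` is non-empty.) -/
def cycleLength (n : ℕ) (τ : ℕ → ℝ) (X S : ℕ → ℝ) (W : ℕ → ℕ → ℝ) : ℝ :=
  cleared n τ X S W (sInf (findsEmpty n τ X S W))

/-- `∑_{i=1}^{n-1} a_i (e^{-λ τ_i} - e^{-λ τ_{i+1}}) + a_n e^{-λ τ_n}`. -/
def stateSum (lam : ℝ) (n : ℕ) (τ a : ℕ → ℝ) : ℝ :=
  ∑ i ∈ Finset.Ico 1 n, a i * (Real.exp (-lam * τ i) - Real.exp (-lam * τ (i + 1)))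
    + a n * Real.exp (-lam * τ n)

/-- The closed form `L`. -/
def closedL (lam mu f : ℝ) (n : ℕ) (τ w : ℕ → ℝ) : ℝ :=
  (mu * f + mu * f * lam * stateSum lam n τ w) / (lam * (mu * f - lam))

/-- The closed form of the average power. -/
def closedPower (lam mu f : ℝ) (n : ℕ) (P τ w : ℕ → ℝ) : ℝ :=
  1 / (lam * closedL lam mu f n τ w) * stateSum lam n τ P
    + P 0 * (1 - Real.exp (-lam * τ 1) / (lam * closedL lam mu f n τ w))

end SleepServer

end

/-!
The whole evolution is read off at the arrivals. Write `Y k = X k - lag k`, where `lag k` is the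
time from arrival `k - 1` until the first `k` jobs are completed. Job `k` finds the system empty
iff `0 ≤ Y k`, and `max (Y k) 0` is the idle period that it ends. As `lag k` depends only on what
has happened before `X k` is drawn, the memoryless property gives `E (h (Y k) | past) = 0` for
every `h` that vanishes on the negative numbers and has mean zero under the exponential law
(`integral_mul_comp_excess_eq_zero`). No regeneration argument is needed: the variables `h (Y k)`
are orthogonal, so they obey a strong law (`strong_law_orthogonal`, `strong_law_excess`). A
truncation gives the same for the wake-up latencies, which have only a first moment
(`strong_law_thinned`).

The average power. The time up to the completion of `N` jobs splits into idle periods, wake-ups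
and services (`cleared_eq_sum`). If `M` of the first `N` jobs find the system empty, the idle
periods amount to `M / lam`, the wake-ups to `M * V` with `V = stateSum w`, and the services to
`N / (mu * f)`, all up to `o(N)`. By stability the backlog is `o(N)` (`tendsto_lag_div`), so the
total is `N / lam` up to `o(N)`. Hence `M / N` converges to
`p = (1 / lam - 1 / (mu * f)) / (1 / lam + V)` (`tendsto_empty_fraction`). The energy of an idle
period is a combination of the functions `max (Y k - τ i) 0`, so its average per job converges as
well, and passing from jobs to time gives the almost sure limit (`tendsto_average_power`). The
power is bounded, so its expectation converges too.

The mean cycle. If `K` jobs are served in the first cycle, then by Wald's identity and the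
memoryless property the balance of arrivals and services over the cycle is
`(1 / lam - 1 / (mu * f)) * E K = V + 1 / lam` (`integral_cycleLength`). Stopped after `N` jobs,
the balance bounds `E (min K N)`; the term for unfinished cycles then vanishes by dominated
convergence. The cycle consists of an idle period, a wake-up and `K` services, which gives `L`.
-/

namespace SleepServer

/-! ### The exponential law -/

lemma measurable_gammaPDF_one (r : ℝ) : Measurable (gammaPDF 1 r) :=
  (measurable_gammaPDFReal 1 r).ennreal_ofReal

lemma expMeasure_density_toReal {r : ℝ} (hr : 0 < r) (x : ℝ) :
    (gammaPDF 1 r x).toReal = if 0 ≤ x then r * Real.exp (-(r * x)) else 0 := by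
  have h := exponentialPDF_eq r x
  rw [exponentialPDF, exponentialPDFReal] at h
  rw [gammaPDF, h, ENNReal.toReal_ofReal]
  split_ifs <;> positivity

lemma integral_expMeasure {r : ℝ} (hr : 0 < r) (φ : ℝ → ℝ) :
    ∫ x, φ x ∂expMeasure r = ∫ x, (if 0 ≤ x then r * Real.exp (-(r * x)) else 0) * φ x := by
  rw [expMeasure, gammaMeasure, integral_withDensity_eq_integral_toReal_smul
    (measurable_gammaPDF_one r) (by simp [gammaPDF])]
  simp_rw [expMeasure_density_toReal hr, smul_eq_mul]

lemma ae_nonneg_expMeasure (r : ℝ) : ∀ᵐ x ∂expMeasure r, 0 ≤ x := by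
  rw [expMeasure, gammaMeasure, ae_withDensity_iff (measurable_gammaPDF_one r)]
  refine Eventually.of_forall fun x hx => ?_
  by_contra h
  exact hx (gammaPDF_of_neg (not_le.1 h))

lemma memLp_two_id_expMeasure {r : ℝ} (hr : 0 < r) : MemLp (fun x : ℝ => x) 2 (expMeasure r) := by
  rw [memLp_two_iff_integrable_sq (by fun_prop), expMeasure, gammaMeasure,
    integrable_withDensity_iff_integrable_smul' (measurable_gammaPDF_one r)
      (by simp [gammaPDF])]
  simp_rw [expMeasure_density_toReal hr]
  have h : IntegrableOn (fun x : ℝ => r * (x ^ (2 : ℝ) * Real.exp (-r * x ^ (1 : ℝ))))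
      (Set.Ioi 0) :=
    (integrableOn_rpow_mul_exp_neg_mul_rpow (by norm_num) (by norm_num) hr).const_mul r
  rw [← integrableOn_Ici_iff_integrableOn_Ioi, ← integrable_indicator_iff measurableSet_Ici] at h
  refine h.congr (Eventually.of_forall fun x => ?_)
  by_cases hx : 0 ≤ x <;> simp [hx, Set.indicator]
  ring

lemma integral_id_expMeasure {r : ℝ} (hr : 0 < r) : ∫ x, x ∂expMeasure r = 1 / r := by
  rw [integral_expMeasure hr]
  have h := Real.integral_rpow_mul_exp_neg_mul_Ioi (a := 2) (r := r) (by norm_num) hr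
  rw [← integral_Ici_eq_integral_Ioi, ← integral_indicator measurableSet_Ici] at h
  calc _ = ∫ x, r * (Set.Ici (0 : ℝ)).indicator
        (fun t => t ^ ((2 : ℝ) - 1) * Real.exp (-(r * t))) x := by
        congr 1; ext x
        by_cases hx : 0 ≤ x
        · simp only [hx, if_true, Set.indicator, Set.mem_Ici]
          norm_num; ring
        · simp [hx, Set.indicator]
    _ = 1 / r := by
        rw [integral_const_mul, h, Real.Gamma_two]
        norm_num
        field_simp

/-- The memoryless property: on an exponential time that exceeds `b`, the excess over `b` is again
exponential. -/
lemma integral_shift_expMeasure {r : ℝ} (hr : 0 < r) {h : ℝ → ℝ} (h0 : ∀ y < 0, h y = 0) {b : ℝ}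
    (hb : 0 ≤ b) :
    ∫ x, h (x - b) ∂expMeasure r = Real.exp (-r * b) * ∫ x, h x ∂expMeasure r := by
  rw [integral_expMeasure hr, integral_expMeasure hr, ← integral_const_mul,
    ← integral_sub_right_eq_self (fun x => Real.exp (-r * b) * _) b]
  congr 1; ext x
  rcases lt_or_ge (x - b) 0 with hx | hx
  · simp [h0 _ hx]
  · have e : Real.exp (-(r * x)) = Real.exp (-r * b) * Real.exp (-(r * (x - b))) := by
      rw [← Real.exp_add]; ring_nf
    rw [if_pos hx, if_pos (by linarith), e]
    ring

lemma integral_ramp_expMeasure {r : ℝ} (hr : 0 < r) {b : ℝ} (hb : 0 ≤ b) :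
    ∫ x, max (x - b) 0 ∂expMeasure r = Real.exp (-r * b) / r := by
  rw [integral_shift_expMeasure hr (h := fun y => max y 0) (fun y hy => max_eq_right hy.le) hb,
    integral_congr_ae (g := fun x => x), integral_id_expMeasure hr]
  · ring
  · filter_upwards [ae_nonneg_expMeasure r] with x hx using max_eq_left hx

lemma integral_step_expMeasure {r : ℝ} (hr : 0 < r) {b : ℝ} (hb : 0 ≤ b) :
    ∫ x, (if b ≤ x then (1 : ℝ) else 0) ∂expMeasure r = Real.exp (-r * b) := by
  have := isProbabilityMeasure_expMeasure hr
  have h := integral_shift_expMeasure hr (h := fun y => if 0 ≤ y then (1 : ℝ) else 0)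
    (fun y hy => if_neg (not_le.2 hy)) hb
  simp only [sub_nonneg] at h
  rw [h, integral_congr_ae (g := fun _ => (1 : ℝ))]
  · simp
  · filter_upwards [ae_nonneg_expMeasure r] with x hx using if_pos hx

/-! ### Strong laws of large numbers -/

section Slln

variable {Ω : Type*} [MeasurableSpace Ω] {Pr : Measure Ω}

/-- Strong law for orthogonal random variables with bounded second moments: along the squares
`n ^ 2` the averages converge because their second moments are summable, and the sum of the absolute
values over the block between two consecutive squares is negligible. -/
lemma strong_law_orthogonal {ξ : ℕ → Ω → ℝ} (hL2 : ∀ k, MemLp (ξ k) 2 Pr) {C : ℝ}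
    (hC : ∀ k, ∫ ω, ξ k ω ^ 2 ∂Pr ≤ C) (horth : ∀ j k, j < k → ∫ ω, ξ j ω * ξ k ω ∂Pr = 0) :
    ∀ᵐ ω ∂Pr, Tendsto (fun N : ℕ => (∑ k ∈ Finset.range N, ξ k ω) / N) atTop (𝓝 0) := by
  have hC0 : 0 ≤ C := (integral_nonneg fun ω => sq_nonneg _).trans (hC 0)
  have hsq : ∀ k, Integrable (fun ω => ξ k ω ^ 2) Pr := fun k => (hL2 k).integrable_sq
  have hprod : ∀ j k, Integrable (fun ω => ξ j ω * ξ k ω) Pr :=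
    fun j k => (hL2 j).integrable_mul (hL2 k)
  -- second moment of a partial sum
  have hsum : ∀ N, ∫ ω, (∑ k ∈ Finset.range N, ξ k ω) ^ 2 ∂Pr ≤ N * C := by
    intro N
    induction N with
    | zero => simp
    | succ N ih =>
      have e : ∀ ω, (∑ k ∈ Finset.range (N + 1), ξ k ω) ^ 2 =
          (∑ k ∈ Finset.range N, ξ k ω) ^ 2 + 2 * (∑ k ∈ Finset.range N, ξ k ω * ξ N ω)
            + ξ N ω ^ 2 := by
        intro ω; rw [Finset.sum_range_succ, ← Finset.sum_mul]; ring
      have i1 : Integrable (fun ω => (∑ k ∈ Finset.range N, ξ k ω) ^ 2) Pr :=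
        (memLp_finsetSum _ fun k _ => hL2 k).integrable_sq
      have i2 : Integrable (fun ω => 2 * (∑ k ∈ Finset.range N, ξ k ω * ξ N ω)) Pr :=
        (integrable_finsetSum _ fun k _ => hprod k N).const_mul 2
      simp_rw [e]
      rw [integral_add (by exact i1.add i2) (hsq N), integral_add i1 i2, integral_const_mul,
        integral_finsetSum _ fun k _ => hprod k N,
        Finset.sum_eq_zero fun k hk => horth k N (Finset.mem_range.1 hk)]
      have := hC N
      push_cast
      linarith
  let T : ℕ → Ω → ℝ := fun n ω => ∑ k ∈ Finset.range (n ^ 2), ξ k ω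
  let R : ℕ → Ω → ℝ := fun n ω => ∑ k ∈ Finset.Ico (n ^ 2) ((n + 1) ^ 2), |ξ k ω|
  have hcard : ∀ n : ℕ, ((Finset.Ico (n ^ 2) ((n + 1) ^ 2)).card : ℝ) = 2 * n + 1 := by
    intro n
    have : (n + 1) ^ 2 - n ^ 2 = 2 * n + 1 := by
      rw [Nat.sub_eq_iff_eq_add (by gcongr; omega)]; ring
    rw [Nat.card_Ico, this]; push_cast; ring
  have hTi : ∀ n, Integrable (fun ω => T n ω ^ 2) Pr := fun n =>
    (memLp_finsetSum _ fun k _ => hL2 k).integrable_sq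
  have hRi : ∀ n, Integrable (fun ω => R n ω ^ 2) Pr := fun n =>
    (memLp_finsetSum _ fun k _ => (hL2 k).abs).integrable_sq
  have hR : ∀ n : ℕ, ∫ ω, R n ω ^ 2 ∂Pr ≤ (2 * n + 1) ^ 2 * C := by
    intro n
    calc ∫ ω, R n ω ^ 2 ∂Pr
        ≤ ∫ ω, (2 * n + 1) * ∑ k ∈ Finset.Ico (n ^ 2) ((n + 1) ^ 2), ξ k ω ^ 2 ∂Pr := by
          refine integral_mono (hRi n) ((integrable_finsetSum _ fun k _ => hsq k).const_mul _) ?_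
          intro ω
          have := sq_sum_le_card_mul_sum_sq (s := Finset.Ico (n ^ 2) ((n + 1) ^ 2))
            (f := fun k => |ξ k ω|)
          rw [hcard] at this
          simpa [R] using this
      _ ≤ (2 * n + 1) * ∑ k ∈ Finset.Ico (n ^ 2) ((n + 1) ^ 2), C := by
          rw [integral_const_mul, integral_finsetSum _ fun k _ => hsq k]
          gcongr with k
          exact hC k
      _ = (2 * n + 1) ^ 2 * C := by
          rw [Finset.sum_const, nsmul_eq_mul, hcard]; ring
  let Q : ℕ → Ω → ℝ := fun n ω => (T n ω ^ 2 + R n ω ^ 2) / (n : ℝ) ^ 4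
  have hQ0 : ∀ n ω, 0 ≤ Q n ω := fun n ω => by positivity
  have hQi : ∀ n, Integrable (Q n) Pr := fun n => ((hTi n).add (hRi n)).div_const _
  have hQ : ∀ n : ℕ, ∫ ω, Q n ω ∂Pr ≤ 10 * C * (1 / (n : ℝ) ^ 2) := by
    intro n
    rcases Nat.eq_zero_or_pos n with rfl | hn
    · simp [Q]
    have hn1 : (1 : ℝ) ≤ n := by exact_mod_cast hn
    have h1 := hsum (n ^ 2)
    have h2 := hR n
    simp only [Q]
    rw [integral_div, integral_add (hTi n) (hRi n), div_le_iff₀ (by positivity)]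
    push_cast at h1
    have h3 : (2 * (n : ℝ) + 1) ^ 2 * C ≤ 9 * n ^ 2 * C := by gcongr; nlinarith
    have h4 : 10 * C * (1 / (n : ℝ) ^ 2) * n ^ 4 = 10 * n ^ 2 * C := by field_simp
    rw [h4]
    simp only [T]
    linarith
  have hQsum : Summable fun n => ∫ ω, Q n ω ∂Pr :=
    Summable.of_nonneg_of_le (fun n => integral_nonneg (hQ0 n)) hQ
      ((Real.summable_one_div_nat_pow.2 (by norm_num)).mul_left _)
  have hfin : ∫⁻ ω, ∑' n, ENNReal.ofReal (Q n ω) ∂Pr ≠ ⊤ := by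
    rw [lintegral_tsum fun n => (hQi n).aestronglyMeasurable.aemeasurable.ennreal_ofReal]
    simp_rw [← ofReal_integral_eq_lintegral_ofReal (hQi _) (Eventually.of_forall (hQ0 _))]
    exact hQsum.tsum_ofReal_ne_top
  have hae : ∀ᵐ ω ∂Pr, Tendsto (fun n => Q n ω) atTop (𝓝 0) := by
    filter_upwards [ae_lt_top' (AEMeasurable.tsum fun n =>
      (hQi n).aestronglyMeasurable.aemeasurable.ennreal_ofReal) hfin] with ω hω
    have := ENNReal.tendsto_atTop_zero_of_tsum_ne_top hω.ne
    have := (ENNReal.tendsto_toReal ENNReal.zero_ne_top).comp this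
    refine (tendsto_congr fun n => ?_).1 this
    exact ENNReal.toReal_ofReal (hQ0 n ω)
  filter_upwards [hae] with ω hω
  have hsqrt : Tendsto (fun N : ℕ => Nat.sqrt N) atTop atTop :=
    tendsto_atTop_atTop.2 fun b => ⟨b ^ 2, fun a ha => by
      simpa [pow_two] using (Nat.le_sqrt'.2 ha)⟩
  have h0 : Tendsto (fun N : ℕ => 2 * √(Q (Nat.sqrt N) ω)) atTop (𝓝 0) := by
    have := ((Real.continuous_sqrt.tendsto 0).comp (hω.comp hsqrt)).const_mul 2
    simpa using this
  refine squeeze_zero_norm' ?_ h0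
  filter_upwards [eventually_ge_atTop 1] with N hN
  set n := Nat.sqrt N
  have hn : 1 ≤ n := Nat.le_sqrt'.2 (by simpa using hN)
  have hn1 : n ^ 2 ≤ N := Nat.sqrt_le' N
  have hn2 : N < (n + 1) ^ 2 := Nat.lt_succ_sqrt' N
  have hnp : (0 : ℝ) < n := by exact_mod_cast hn
  have hsplit : |∑ k ∈ Finset.range N, ξ k ω| ≤ |T n ω| + R n ω := by
    rw [← Finset.sum_range_add_sum_Ico _ hn1]
    refine (abs_add_le _ _).trans (add_le_add le_rfl ((Finset.abs_sum_le_sum_abs _ _).trans ?_))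
    exact Finset.sum_le_sum_of_subset_of_nonneg (Finset.Ico_subset_Ico le_rfl hn2.le)
      fun _ _ _ => abs_nonneg _
  have hT : |T n ω| ≤ √(Q n ω) * n ^ 2 := by
    rw [← Real.sqrt_sq_eq_abs]
    have : (n : ℝ) ^ 2 = √((n : ℝ) ^ 4) := by
      rw [show (n : ℝ) ^ 4 = (n ^ 2) ^ 2 by ring, Real.sqrt_sq (by positivity)]
    rw [this, ← Real.sqrt_mul (hQ0 _ _)]
    refine Real.sqrt_le_sqrt ?_
    simp only [Q]
    rw [div_mul_cancel₀ _ (by positivity)]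
    nlinarith [sq_nonneg (R n ω)]
  have hRR : R n ω ≤ √(Q n ω) * n ^ 2 := by
    refine (le_abs_self _).trans ?_
    rw [← Real.sqrt_sq_eq_abs]
    have : (n : ℝ) ^ 2 = √((n : ℝ) ^ 4) := by
      rw [show (n : ℝ) ^ 4 = (n ^ 2) ^ 2 by ring, Real.sqrt_sq (by positivity)]
    rw [this, ← Real.sqrt_mul (hQ0 _ _)]
    refine Real.sqrt_le_sqrt ?_
    simp only [Q]
    rw [div_mul_cancel₀ _ (by positivity)]
    nlinarith [sq_nonneg (T n ω)]
  have hNp : (0 : ℝ) < N := by exact_mod_cast hN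
  rw [Real.norm_eq_abs, abs_div, abs_of_pos hNp, div_le_iff₀ hNp]
  have hle : √(Q n ω) * (n : ℝ) ^ 2 ≤ √(Q n ω) * N :=
    mul_le_mul_of_nonneg_left (by exact_mod_cast hn1) (Real.sqrt_nonneg _)
  linarith

/-- An exponential time `X` that has survived an independent random time `B` starts afresh: any
function of the excess `X - B` with zero mean under the exponential law is uncorrelated with
everything that is, jointly with `B`, independent of `X`. -/
lemma integral_mul_comp_excess_eq_zero [IsProbabilityMeasure Pr] {r : ℝ} (hr : 0 < r)
    {Y B X : Ω → ℝ} (hind : IndepFun (fun ω => (Y ω, B ω)) X Pr) (hY : Measurable Y)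
    (hB : Measurable B) (hX : Measurable X) (hlaw : Pr.map X = expMeasure r)
    (hB0 : ∀ᵐ ω ∂Pr, 0 ≤ B ω) {h : ℝ → ℝ} (hh : Measurable h) (h0 : ∀ y < 0, h y = 0)
    (hmean : ∫ x, h x ∂expMeasure r = 0)
    (hint : Integrable (fun ω => Y ω * h (X ω - B ω)) Pr) :
    ∫ ω, Y ω * h (X ω - B ω) ∂Pr = 0 := by
  have := isProbabilityMeasure_expMeasure hr
  have hm : Measurable fun p : (ℝ × ℝ) × ℝ => p.1.1 * h (p.2 - p.1.2) := by fun_prop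
  have hYB : Measurable fun ω => (Y ω, B ω) := hY.prodMk hB
  have hmap := (indepFun_iff_map_prod_eq_prod_map_map hYB.aemeasurable hX.aemeasurable).1 hind
  rw [hlaw] at hmap
  have hpair : Measurable fun ω => ((Y ω, B ω), X ω) := hYB.prodMk hX
  have hprob : IsProbabilityMeasure (Pr.map fun ω => (Y ω, B ω)) :=
    Measure.isProbabilityMeasure_map hYB.aemeasurable
  have hint' : Integrable (fun p : (ℝ × ℝ) × ℝ => p.1.1 * h (p.2 - p.1.2))
      ((Pr.map fun ω => (Y ω, B ω)).prod (expMeasure r)) := by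
    rw [← hmap, integrable_map_measure hm.aestronglyMeasurable hpair.aemeasurable]
    exact hint
  calc ∫ ω, Y ω * h (X ω - B ω) ∂Pr
      = ∫ p, p.1.1 * h (p.2 - p.1.2) ∂((Pr.map fun ω => (Y ω, B ω)).prod (expMeasure r)) := by
        rw [← hmap, integral_map hpair.aemeasurable hm.aestronglyMeasurable]
    _ = ∫ u, ∫ x, u.1 * h (x - u.2) ∂expMeasure r ∂(Pr.map fun ω => (Y ω, B ω)) :=
        integral_prod _ hint'
    _ = ∫ u : ℝ × ℝ, 0 ∂(Pr.map fun ω => (Y ω, B ω)) := by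
        refine integral_congr_ae ?_
        rw [EventuallyEq, ae_map_iff hYB.aemeasurable]
        · filter_upwards [hB0] with ω hω
          rw [integral_const_mul, integral_shift_expMeasure hr h0 hω, hmean]
          simp
        · have : StronglyMeasurable fun u : ℝ × ℝ => ∫ x, u.1 * h (x - u.2) ∂expMeasure r :=
            hm.stronglyMeasurable.integral_prod_right'
          exact measurableSet_eq_fun this.measurable measurable_const
    _ = 0 := by simp

/-- Strong law for functionals of the excesses `X k - B k` of exponential times over random times
`B k` determined by the past. -/
lemma strong_law_excess [IsProbabilityMeasure Pr] {r : ℝ} (hr : 0 < r) {X B : ℕ → Ω → ℝ}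
    (hX : ∀ k, Measurable (X k)) (hB : ∀ k, Measurable (B k))
    (hlaw : ∀ k, Pr.map (X k) = expMeasure r) (hB0 : ∀ k, ∀ᵐ ω ∂Pr, 0 ≤ B k ω)
    (hind : ∀ j k, j < k → IndepFun (fun ω => (X j ω - B j ω, B k ω)) (X k) Pr)
    {h : ℝ → ℝ} (hh : Measurable h) (h0 : ∀ y < 0, h y = 0)
    (hmean : ∫ x, h x ∂expMeasure r = 0) {c : ℝ} (hc : 0 ≤ c)
    (hbound : ∀ y, 0 ≤ y → |h y| ≤ y + c) :
    ∀ᵐ ω ∂Pr, Tendsto (fun N : ℕ => (∑ k ∈ Finset.range N, h (X k ω - B k ω)) / N) atTop (𝓝 0) := by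
  have hm : ∀ k, Measurable fun ω => h (X k ω - B k ω) := fun k => by fun_prop
  have hXL2 : ∀ k, MemLp (fun ω => |X k ω| + c) 2 Pr := by
    intro k
    have h1 : MemLp (fun x : ℝ => |x| + c) 2 (Pr.map (X k)) := by
      have := isProbabilityMeasure_expMeasure hr
      rw [hlaw]; exact (memLp_two_id_expMeasure hr).abs.add (memLp_const c)
    exact h1.comp_of_map (hX k).aemeasurable
  have hle : ∀ k, ∀ᵐ ω ∂Pr, |h (X k ω - B k ω)| ≤ |X k ω| + c := by
    intro k
    filter_upwards [hB0 k] with ω hω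
    rcases lt_or_ge (X k ω - B k ω) 0 with hneg | hpos
    · rw [h0 _ hneg, abs_zero]; positivity
    · refine (hbound _ hpos).trans ?_
      have := le_abs_self (X k ω)
      linarith
  have hL2 : ∀ k, MemLp (fun ω => h (X k ω - B k ω)) 2 Pr := fun k =>
    (hXL2 k).of_le (hm k).aestronglyMeasurable <| by
      filter_upwards [hle k] with ω hω
      exact hω.trans (le_abs_self _)
  refine strong_law_orthogonal (C := ∫ x, (|x| + c) ^ 2 ∂expMeasure r) hL2 (fun k => ?_)
    fun j k hjk => ?_
  · have e : ∫ x, (|x| + c) ^ 2 ∂expMeasure r = ∫ ω, (|X k ω| + c) ^ 2 ∂Pr := by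
      rw [← hlaw k, integral_map (hX k).aemeasurable (by fun_prop)]
    rw [e]
    refine integral_mono_ae (hL2 k).integrable_sq (hXL2 k).integrable_sq ?_
    filter_upwards [hle k] with ω hω
    exact sq_le_sq' (by linarith [neg_abs_le (h (X k ω - B k ω))]) ((le_abs_self _).trans hω)
  · refine integral_mul_comp_excess_eq_zero hr (Y := fun ω => h (X j ω - B j ω)) ?_ (hm j) (hB k)
      (hX k) (hlaw k) (hB0 k) hh h0 hmean ((hL2 j).integrable_mul (hL2 k))
    exact (hind j k hjk).comp (φ := fun p : ℝ × ℝ => (h p.1, p.2)) (by fun_prop) measurable_id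

/-- Strong law for identically distributed variables `V k` counted with random weights `c k` that
are determined before `V k` is drawn. Only a first moment is available, so the `V k` are truncated
at a level `M`: the truncated part has orthogonal increments, and the excess over `M` is dominated
by its unweighted averages. -/
lemma strong_law_thinned [IsProbabilityMeasure Pr] {V c : ℕ → Ω → ℝ} (hV : ∀ k, Measurable (V k))
    (hc : ∀ k, Measurable (c k)) (hc0 : ∀ k ω, 0 ≤ c k ω) (hc1 : ∀ k ω, c k ω ≤ 1)
    (hint : Integrable (V 0) Pr) (hident : ∀ k, IdentDistrib (V k) (V 0) Pr Pr)
    (hind : ∀ j k, j < k → IndepFun (fun ω => ((V j ω, c j ω), c k ω)) (V k) Pr) :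
    ∀ᵐ ω ∂Pr, Tendsto (fun N : ℕ =>
      (∑ k ∈ Finset.range N, (V k ω - ∫ ω, V 0 ω ∂Pr) * c k ω) / N) atTop (𝓝 0) := by
  set m := ∫ ω, V 0 ω ∂Pr with hm
  -- truncation at level `M`, and the remainder
  let φ : ℕ → ℝ → ℝ := fun M v => max (min v M) (-M)
  let ρ : ℕ → ℝ → ℝ := fun M v => max (|v| - M) 0
  have hφm : ∀ M, Measurable (φ M) := fun M => by fun_prop
  have hρm : ∀ M, Measurable (ρ M) := fun M => by fun_prop
  have hφb : ∀ M v, |φ M v| ≤ M := fun M v => by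
    have : (0 : ℝ) ≤ M := Nat.cast_nonneg M
    rw [abs_le]
    exact ⟨le_max_right _ _, max_le (min_le_right _ _) (by linarith)⟩
  have hφρ : ∀ M v, |v - φ M v| = ρ M v := fun M v => by
    have : (0 : ℝ) ≤ M := Nat.cast_nonneg M
    simp only [φ, ρ]
    grind
  have hρ0 : ∀ M v, 0 ≤ ρ M v := fun M v => le_max_right _ _
  have hρle : ∀ M v, ρ M v ≤ |v| := fun M v =>
    max_le (by linarith [(Nat.cast_nonneg M : (0 : ℝ) ≤ M)]) (abs_nonneg v)
  have hφi : ∀ M k, Integrable (fun ω => φ M (V k ω)) Pr := fun M k =>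
    Integrable.of_bound ((hφm M).comp (hV k)).aestronglyMeasurable M
      (Eventually.of_forall fun ω => hφb M _)
  have hρi : ∀ M, Integrable (fun ω => ρ M (V 0 ω)) Pr := fun M =>
    hint.abs.mono' ((hρm M).comp (hV 0)).aestronglyMeasurable
      (Eventually.of_forall fun ω => by
        rw [Real.norm_eq_abs, abs_of_nonneg (hρ0 M _)]; exact hρle M _)
  let mM : ℕ → ℝ := fun M => ∫ ω, φ M (V 0 ω) ∂Pr
  let ε : ℕ → ℝ := fun M => ∫ ω, ρ M (V 0 ω) ∂Pr
  have hmb : ∀ M, |mM M| ≤ M := fun M => by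
    have := norm_integral_le_of_norm_le_const (μ := Pr) (f := fun ω => φ M (V 0 ω))
      (Eventually.of_forall fun ω => hφb M (V 0 ω))
    simpa using this
  have hmm : ∀ M, |mM M - m| ≤ ε M := fun M => by
    rw [abs_sub_comm, hm, ← integral_sub hint (hφi M 0)]
    refine abs_integral_le_integral_abs.trans
      (integral_mono ((hint.sub (hφi M 0)).abs) (hρi M) ?_)
    intro ω
    exact (hφρ M _).le
  have hε : Tendsto ε atTop (𝓝 0) := by
    have : Tendsto ε atTop (𝓝 (∫ ω, (0 : ℝ) ∂Pr)) := by
      refine tendsto_integral_of_dominated_convergence (fun ω => |V 0 ω|)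
        (fun M => (hρi M).aestronglyMeasurable) hint.abs ?_ ?_
      · exact fun M => Eventually.of_forall fun ω => by
          rw [Real.norm_eq_abs, abs_of_nonneg (hρ0 M _)]; exact hρle M _
      · refine Eventually.of_forall fun ω => tendsto_const_nhds.congr' ?_
        obtain ⟨M0, hM0⟩ := exists_nat_ge |V 0 ω|
        filter_upwards [eventually_ge_atTop M0] with M hM
        have : (M0 : ℝ) ≤ M := by exact_mod_cast hM
        exact (max_eq_right (by linarith)).symm
    simpa using this
  -- the truncated variables have orthogonal increments
  have htrunc : ∀ M, ∀ᵐ ω ∂Pr, Tendsto (fun N : ℕ =>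
      (∑ k ∈ Finset.range N, (φ M (V k ω) - mM M) * c k ω) / N) atTop (𝓝 0) := by
    intro M
    have hmeas : ∀ k, Measurable fun ω => (φ M (V k ω) - mM M) * c k ω := fun k =>
      (((hφm M).comp (hV k)).sub_const _).mul (hc k)
    have hb : ∀ k ω, |(φ M (V k ω) - mM M) * c k ω| ≤ 2 * M := by
      intro k ω
      rw [abs_mul, abs_of_nonneg (hc0 k ω)]
      have h1 : |φ M (V k ω) - mM M| ≤ 2 * M := by
        refine (abs_sub _ _).trans ?_
        linarith [hφb M (V k ω), hmb M]
      calc _ ≤ |φ M (V k ω) - mM M| * 1 := by gcongr; exact hc1 k ω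
        _ ≤ _ := by linarith
    have hL2 : ∀ k, MemLp (fun ω => (φ M (V k ω) - mM M) * c k ω) 2 Pr := fun k =>
      MemLp.of_bound (hmeas k).aestronglyMeasurable (2 * M) (Eventually.of_forall (hb k))
    refine strong_law_orthogonal (C := (2 * M) ^ 2) hL2 (fun k => ?_) fun j k hjk => ?_
    · have := integral_mono (hL2 k).integrable_sq (integrable_const ((2 * (M : ℝ)) ^ 2))
        fun ω => sq_le_sq' (neg_le_of_abs_le (hb k ω)) (le_of_abs_le (hb k ω))
      simpa using this
    · have hi := (hind j k hjk).comp
        (φ := fun p : (ℝ × ℝ) × ℝ => ((φ M p.1.1 - mM M) * p.1.2) * p.2)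
        (ψ := fun v => φ M v - mM M) (by fun_prop) (by fun_prop)
      have h2 := hi.integral_fun_mul_eq_mul_integral
        (Measurable.aestronglyMeasurable (by fun_prop))
        (Measurable.aestronglyMeasurable (by fun_prop))
      have h3 : ∫ ω, ((fun v => φ M v - mM M) ∘ V k) ω ∂Pr = 0 := by
        simp only [Function.comp]
        rw [integral_sub (hφi M k) (integrable_const _)]
        have := ((hident k).comp (hφm M)).integral_eq
        simp only [Function.comp_def] at this
        simp [this, mM]
      rw [h3, mul_zero] at h2
      rw [← h2]
      congr 1; ext ω; simp only [Function.comp]; ring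
  have hrem : ∀ M, ∀ᵐ ω ∂Pr, Tendsto (fun N : ℕ =>
      (∑ k ∈ Finset.range N, ρ M (V k ω)) / N) atTop (𝓝 (ε M)) := by
    intro M
    refine strong_law_ae_real (fun k ω => ρ M (V k ω)) (hρi M) ?_ fun k => (hident k).comp (hρm M)
    have key : ∀ j k, j < k → IndepFun (fun ω => ρ M (V j ω)) (fun ω => ρ M (V k ω)) Pr :=
      fun j k hjk => (hind j k hjk).comp
        (φ := fun p : (ℝ × ℝ) × ℝ => ρ M p.1.1) (by fun_prop) (hρm M)
    intro j k hjk
    rcases lt_or_gt_of_ne hjk with h | h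
    · exact key j k h
    · exact (key k j h).symm
  filter_upwards [ae_all_iff.2 htrunc, ae_all_iff.2 hrem] with ω h1 h2
  rw [Metric.tendsto_atTop']
  intro δ hδ
  obtain ⟨M, hM⟩ := ((tendsto_order.1 hε).2 (δ / 2) (by linarith)).exists
  have hlim : Tendsto (fun N : ℕ => |(∑ k ∈ Finset.range N, (φ M (V k ω) - mM M) * c k ω) / N| +
      (∑ k ∈ Finset.range N, ρ M (V k ω)) / N + ε M) atTop (𝓝 (|0| + ε M + ε M)) :=
    ((h1 M).abs.add (h2 M)).add_const _
  have hev := (tendsto_order.1 hlim).2 δ (by rw [abs_zero]; linarith)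
  obtain ⟨N0, hN0⟩ := (hev.and (eventually_ge_atTop 1)).exists_forall_of_atTop
  refine ⟨N0, fun N hN => ?_⟩
  obtain ⟨h3, hN1⟩ := hN0 N hN.le
  have hNp : (0 : ℝ) < N := by exact_mod_cast hN1
  rw [dist_zero_right, Real.norm_eq_abs]
  refine lt_of_le_of_lt ?_ h3
  rw [abs_div, abs_div, abs_of_pos hNp, ← add_div, ← sub_nonneg]
  have hb : |∑ k ∈ Finset.range N, (V k ω - m) * c k ω| ≤
      |∑ k ∈ Finset.range N, (φ M (V k ω) - mM M) * c k ω| + ∑ k ∈ Finset.range N, ρ M (V k ω)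
        + ε M * N := by
    have e : ∑ k ∈ Finset.range N, (V k ω - m) * c k ω =
        ∑ k ∈ Finset.range N, (φ M (V k ω) - mM M) * c k ω +
          ∑ k ∈ Finset.range N, ((V k ω - φ M (V k ω)) + (mM M - m)) * c k ω := by
      rw [← Finset.sum_add_distrib]
      refine Finset.sum_congr rfl fun k _ => ?_
      ring
    rw [e, add_assoc]
    refine (abs_add_le _ _).trans (add_le_add le_rfl ((Finset.abs_sum_le_sum_abs _ _).trans ?_))
    have : ∑ k ∈ Finset.range N, ρ M (V k ω) + ε M * N =
        ∑ k ∈ Finset.range N, (ρ M (V k ω) + ε M) := by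
      rw [Finset.sum_add_distrib]; simp [mul_comm]
    rw [this]
    refine Finset.sum_le_sum fun k _ => ?_
    rw [abs_mul, abs_of_nonneg (hc0 k ω)]
    calc _ ≤ |V k ω - φ M (V k ω) + (mM M - m)| * 1 := by gcongr; exact hc1 k ω
      _ ≤ _ := by
        rw [mul_one, ← hφρ]
        exact (abs_add_le _ _).trans (add_le_add le_rfl (hmm M))
  have : (|∑ k ∈ Finset.range N, (φ M (V k ω) - mM M) * c k ω|
        + ∑ k ∈ Finset.range N, ρ M (V k ω)) / N
      + ε M - |∑ k ∈ Finset.range N, (V k ω - m) * c k ω| / N =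
      (|∑ k ∈ Finset.range N, (φ M (V k ω) - mM M) * c k ω| + ∑ k ∈ Finset.range N, ρ M (V k ω)
        + ε M * N - |∑ k ∈ Finset.range N, (V k ω - m) * c k ω|) / N := by
    field_simp
  rw [this]
  exact div_nonneg (by linarith) hNp.le

end Slln

/-! ### Sample paths -/

/-- `passed n τ i y` is `1` if state `i` exists (that is, `i ≤ n`) and has been entered by the time
the queue has been empty for `y` seconds, and `0` otherwise. Thanks to the convention for
`i = n + 1`, the server is exactly in state `i` when `passed n τ i y - passed n τ (i + 1) y = 1`. -/
noncomputable def passed (n : ℕ) (τ : ℕ → ℝ) (i : ℕ) (y : ℝ) : ℝ :=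
  if i ≤ n ∧ τ i ≤ y then 1 else 0

/-- The mean of `passed n τ i` under the exponential law of rate `lam`. -/
noncomputable def passedMean (lam : ℝ) (n : ℕ) (τ : ℕ → ℝ) (i : ℕ) : ℝ :=
  if i ≤ n then Real.exp (-lam * τ i) else 0

/-- The time from the arrival of job `k - 1` (from time `0` for `k = 0`) until the first `k` jobs
are completed. Job `k` finds the system empty iff `X k` is at least `lag k`, and the
preceding idle period then has length `X k - lag k`. -/
noncomputable def lag (n : ℕ) (τ : ℕ → ℝ) (X S : ℕ → ℝ) (W : ℕ → ℕ → ℝ) (k : ℕ) : ℝ :=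
  cleared n τ X S W k - ∑ j ∈ Finset.range k, X j

/-- The energy, in excess of that drawn in the active state, used in an idle period of length `x`:
the power changes by `P i - P (i - 1)` when state `i` is entered. -/
noncomputable def idleEnergy (n : ℕ) (P τ : ℕ → ℝ) (x : ℝ) : ℝ :=
  ∑ i ∈ Finset.Icc 1 n, (P i - P (i - 1)) * max (x - τ i) 0

lemma measurable_passed (n : ℕ) (τ : ℕ → ℝ) (i : ℕ) : Measurable (passed n τ i) := by
  unfold passed
  exact Measurable.ite (measurableSet_setOfPred.2 (by
    by_cases h : i ≤ n
    · simpa [h] using measurableSet_setOfPred.1 measurableSet_Ici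
    · simp [h])) measurable_const measurable_const

lemma passed_nonneg (n : ℕ) (τ : ℕ → ℝ) (i : ℕ) (y : ℝ) : 0 ≤ passed n τ i y := by
  unfold passed; split_ifs <;> norm_num

lemma passed_le_one (n : ℕ) (τ : ℕ → ℝ) (i : ℕ) (y : ℝ) : passed n τ i y ≤ 1 := by
  unfold passed; split_ifs <;> norm_num

section Path

variable {n : ℕ} {τ : ℕ → ℝ}

lemma nonneg_of_mem_Icc (hτ0 : 0 ≤ τ 1) (hτ : StrictMonoOn τ (Set.Icc 1 n)) {i : ℕ}
    (hi : i ∈ Finset.Icc 1 n) : 0 ≤ τ i := by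
  rw [Finset.mem_Icc] at hi
  exact hτ0.trans (hτ.monotoneOn ⟨le_rfl, hi.1.trans hi.2⟩ hi hi.1)

lemma idleState_le (s : ℝ) : idleState n τ s ≤ n := Nat.findGreatest_le n

lemma le_idleState_iff (hτ : StrictMonoOn τ (Set.Icc 1 n)) {i : ℕ} (hi : 1 ≤ i) (hin : i ≤ n)
    (s : ℝ) : i ≤ idleState n τ s ↔ τ i ≤ s := by
  classical
  constructor
  · intro h
    have h0 : idleState n τ s ≠ 0 := by omega
    have h1 : τ (idleState n τ s) ≤ s := Nat.findGreatest_of_ne_zero rfl h0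
    exact (hτ.monotoneOn ⟨hi, hin⟩ ⟨by omega, idleState_le s⟩ h).trans h1
  · intro h
    exact Nat.le_findGreatest hin h

lemma passed_eq (hτ : StrictMonoOn τ (Set.Icc 1 n)) {i : ℕ} (hi : 1 ≤ i) (y : ℝ) :
    passed n τ i y = if i ≤ idleState n τ y then 1 else 0 := by
  by_cases h : i ≤ n
  · simp only [passed, le_idleState_iff hτ hi h, h, true_and]
  · have : ¬ i ≤ idleState n τ y := fun h' => h (h'.trans (idleState_le y))
    simp [passed, h, this]

lemma passed_sub_passed (hτ : StrictMonoOn τ (Set.Icc 1 n)) {i : ℕ} (hi : 1 ≤ i) (y : ℝ) :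
    passed n τ i y - passed n τ (i + 1) y = if idleState n τ y = i then 1 else 0 := by
  rw [passed_eq hτ hi, passed_eq hτ (by omega)]
  split_ifs <;> first | omega | norm_num

lemma passed_sub_passed_nonneg (hτ : StrictMonoOn τ (Set.Icc 1 n)) {i : ℕ} (hi : 1 ≤ i) (y : ℝ) :
    0 ≤ passed n τ i y - passed n τ (i + 1) y := by
  rw [passed_sub_passed hτ hi]; split_ifs <;> norm_num

lemma passed_sub_passed_le_one (hτ : StrictMonoOn τ (Set.Icc 1 n)) {i : ℕ} (hi : 1 ≤ i) (y : ℝ) :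
    passed n τ i y - passed n τ (i + 1) y ≤ 1 := by
  rw [passed_sub_passed hτ hi]; split_ifs <;> norm_num

lemma wakeUp_eq_sum (hτ : StrictMonoOn τ (Set.Icc 1 n)) (W : ℕ → ℝ) (y : ℝ) :
    wakeUp n τ W y =
      ∑ i ∈ Finset.Icc 1 n, W i * (passed n τ i y - passed n τ (i + 1) y) := by
  have h : ∀ i ∈ Finset.Icc 1 n, W i * (passed n τ i y - passed n τ (i + 1) y) =
      if idleState n τ y = i then W i else 0 := by
    intro i hi
    rw [passed_sub_passed hτ (Finset.mem_Icc.1 hi).1, mul_ite, mul_one, mul_zero]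
  rw [Finset.sum_congr rfl h, Finset.sum_ite_eq, wakeUp]
  have := idleState_le (n := n) (τ := τ) y
  by_cases h0 : idleState n τ y = 0
  · simp [h0]
  · rw [if_neg h0, if_pos (Finset.mem_Icc.2 ⟨by omega, this⟩)]

lemma idleState_of_neg (hτ0 : 0 ≤ τ 1) (hτ : StrictMonoOn τ (Set.Icc 1 n)) {y : ℝ} (hy : y < 0) :
    idleState n τ y = 0 := by
  by_contra h
  have h1 : 1 ≤ idleState n τ y := by omega
  have := (le_idleState_iff hτ le_rfl (h1.trans (idleState_le y)) y).1 h1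
  linarith

lemma passed_of_neg (hτ0 : 0 ≤ τ 1) (hτ : StrictMonoOn τ (Set.Icc 1 n)) {i : ℕ} (hi : 1 ≤ i)
    {y : ℝ} (hy : y < 0) : passed n τ i y = 0 := by
  rw [passed_eq hτ hi, idleState_of_neg hτ0 hτ hy, if_neg (by omega)]

lemma wakeUp_nonneg {W : ℕ → ℝ} (hW : ∀ i ∈ Finset.Icc 1 n, 0 ≤ W i) (y : ℝ) :
    0 ≤ wakeUp n τ W y := by
  rw [wakeUp]
  split_ifs with h
  · exact le_rfl
  · exact hW _ (Finset.mem_Icc.2 ⟨by omega, idleState_le y⟩)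

lemma wakeUp_le_sum {W : ℕ → ℝ} (hW : ∀ i ∈ Finset.Icc 1 n, 0 ≤ W i) (y : ℝ) :
    wakeUp n τ W y ≤ ∑ i ∈ Finset.Icc 1 n, W i := by
  rw [wakeUp]
  split_ifs with h
  · exact Finset.sum_nonneg hW
  · exact Finset.single_le_sum hW (Finset.mem_Icc.2 ⟨by omega, idleState_le y⟩)

variable {X S : ℕ → ℝ} {W : ℕ → ℕ → ℝ}

lemma arrival_sub_cleared (k : ℕ) :
    arrival X k - cleared n τ X S W k = X k - lag n τ X S W k := by
  rw [arrival, lag, Finset.sum_range_succ]; ring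

/-- The three ways to spend the time between two completions: idling, waking up and serving. -/
lemma cleared_succ (hτ0 : 0 ≤ τ 1) (hτ : StrictMonoOn τ (Set.Icc 1 n)) (k : ℕ) :
    cleared n τ X S W (k + 1) = cleared n τ X S W k + max (X k - lag n τ X S W k) 0
      + wakeUp n τ (fun i => W i k) (X k - lag n τ X S W k) + S k := by
  have h := arrival_sub_cleared (n := n) (τ := τ) (X := X) (S := S) (W := W) k
  rw [cleared, ← h]
  split_ifs with hlt
  · rw [max_eq_right (by linarith), wakeUp, if_pos (idleState_of_neg hτ0 hτ (by linarith))]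
    ring
  · rw [max_eq_left (by linarith)]
    ring

lemma cleared_eq_sum (hτ0 : 0 ≤ τ 1) (hτ : StrictMonoOn τ (Set.Icc 1 n)) (N : ℕ) :
    cleared n τ X S W N = ∑ k ∈ Finset.range N, max (X k - lag n τ X S W k) 0
      + ∑ k ∈ Finset.range N, wakeUp n τ (fun i => W i k) (X k - lag n τ X S W k)
      + ∑ k ∈ Finset.range N, S k := by
  induction N with
  | zero => simp [cleared]
  | succ N ih => rw [cleared_succ hτ0 hτ, ih]; simp only [Finset.sum_range_succ]; ring

lemma lag_zero : lag n τ X S W 0 = 0 := by simp [lag, cleared]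

section Nonneg

variable (hτ0 : 0 ≤ τ 1) (hτ : StrictMonoOn τ (Set.Icc 1 n)) (hS : ∀ k, 0 ≤ S k)
  (hW : ∀ i ∈ Finset.Icc 1 n, ∀ k, 0 ≤ W i k)

include hτ0 hτ hS hW

lemma cleared_le_succ (k : ℕ) : cleared n τ X S W k ≤ cleared n τ X S W (k + 1) := by
  rw [cleared_succ hτ0 hτ]
  have h1 := wakeUp_nonneg (τ := τ) (W := fun i => W i k) (fun i hi => hW i hi k)
    (X k - lag n τ X S W k)
  have h2 := hS k
  have h3 := le_max_right (X k - lag n τ X S W k) 0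
  linarith

lemma monotone_cleared : Monotone (cleared n τ X S W) :=
  monotone_nat_of_le_succ (cleared_le_succ hτ0 hτ hS hW)

lemma arrival_le_cleared_succ (k : ℕ) : arrival X k ≤ cleared n τ X S W (k + 1) := by
  rw [cleared_succ hτ0 hτ]
  have h1 := wakeUp_nonneg (τ := τ) (W := fun i => W i k) (fun i hi => hW i hi k)
    (X k - lag n τ X S W k)
  have h2 := hS k
  have h3 := le_max_left (X k - lag n τ X S W k) 0
  have h4 := arrival_sub_cleared (n := n) (τ := τ) (X := X) (S := S) (W := W) k
  linarith

lemma lag_nonneg (k : ℕ) : 0 ≤ lag n τ X S W k := by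
  cases k with
  | zero => rw [lag_zero]
  | succ k =>
    have := arrival_le_cleared_succ (X := X) hτ0 hτ hS hW k
    rw [lag]; rw [arrival] at this; linarith

omit hS in
/-- The lag at `N` builds up since the last job `k` that found the system empty. -/
lemma exists_lag_eq (hX : ∀ k, 0 ≤ X k) (N : ℕ) :
    ∃ k ≤ N, lag n τ X S W (N + 1) ≤ ∑ i ∈ Finset.Icc 1 n, W i k
      + ∑ j ∈ Finset.Ico k (N + 1), S j - ∑ j ∈ Finset.Ico (k + 1) (N + 1), X j := by
  have empty : ∀ N, 0 ≤ X N - lag n τ X S W N →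
      ∃ k ≤ N, lag n τ X S W (N + 1) ≤ ∑ i ∈ Finset.Icc 1 n, W i k
      + ∑ j ∈ Finset.Ico k (N + 1), S j - ∑ j ∈ Finset.Ico (k + 1) (N + 1), X j := by
    intro N h
    refine ⟨N, le_rfl, ?_⟩
    have h1 := wakeUp_le_sum (τ := τ) (W := fun i => W i N) (fun i hi => hW i hi N)
      (X N - lag n τ X S W N)
    have h2 : lag n τ X S W (N + 1) =
        wakeUp n τ (fun i => W i N) (X N - lag n τ X S W N) + S N := by
      rw [lag, cleared_succ hτ0 hτ, max_eq_left h, Finset.sum_range_succ]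
      simp only [lag]; ring
    simp
    linarith
  induction N with
  | zero => exact empty 0 (by rw [lag_zero]; linarith [hX 0])
  | succ N ih =>
    by_cases h : 0 ≤ X (N + 1) - lag n τ X S W (N + 1)
    · exact empty _ h
    · push Not at h
      obtain ⟨k, hk, hle⟩ := ih
      refine ⟨k, by omega, ?_⟩
      have h2 : lag n τ X S W (N + 1 + 1) = lag n τ X S W (N + 1) + S (N + 1) - X (N + 1) := by
        rw [lag, cleared_succ hτ0 hτ, max_eq_right h.le, Finset.sum_range_succ _ (N + 1), wakeUp,
          if_pos (idleState_of_neg hτ0 hτ h)]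
        simp only [lag]; ring
      rw [h2, Finset.sum_Ico_succ_top (by omega), Finset.sum_Ico_succ_top (by omega) (fun j => X j)]
      linarith

end Nonneg

/-! ### The power -/

lemma power_idle_eq (hτ : StrictMonoOn τ (Set.Icc 1 n)) (P : ℕ → ℝ) (u : ℝ) :
    P (idleState n τ u) =
      P 0 + ∑ i ∈ Finset.Icc 1 n, if τ i ≤ u then P i - P (i - 1) else 0 := by
  have tele : ∀ m, ∑ i ∈ Finset.Icc 1 m, (P i - P (i - 1)) = P m - P 0 := by
    intro m
    induction m with
    | zero => simp
    | succ m ih => rw [Finset.sum_Icc_succ_top (by omega), ih]; simp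
  have h : (Finset.Icc 1 n).filter (fun i => τ i ≤ u) = Finset.Icc 1 (idleState n τ u) := by
    ext i
    have := idleState_le (n := n) (τ := τ) u
    simp only [Finset.mem_filter, Finset.mem_Icc]
    constructor
    · rintro ⟨⟨h1, h2⟩, h3⟩
      exact ⟨h1, (le_idleState_iff hτ h1 h2 u).2 h3⟩
    · rintro ⟨h1, h2⟩
      exact ⟨⟨h1, h2.trans this⟩, (le_idleState_iff hτ h1 (h2.trans this) u).1 h2⟩
  rw [← Finset.sum_filter, h, tele]
  ring

lemma abs_power_le (P : ℕ → ℝ) (t : ℝ) :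
    |power n P τ X S W t| ≤ ∑ i ∈ Finset.range (n + 1), |P i| := by
  have h : ∀ i ≤ n, |P i| ≤ ∑ i ∈ Finset.range (n + 1), |P i| := fun i hi =>
    Finset.single_le_sum (f := fun i => |P i|) (fun _ _ => abs_nonneg _)
      (Finset.mem_range.2 (by omega))
  rw [power]
  split_ifs with hk
  · exact h _ (idleState_le _)
  · exact h 0 (by omega)

section Nonneg

variable (hτ0 : 0 ≤ τ 1) (hτ : StrictMonoOn τ (Set.Icc 1 n)) (hS : ∀ k, 0 ≤ S k)
  (hW : ∀ i ∈ Finset.Icc 1 n, ∀ k, 0 ≤ W i k)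

include hτ0 hτ hS hW

/-- Between the completion of the first `k` and of the first `k + 1` jobs, the power differs from
the active power only while job `k` has not arrived: it then changes by `P i - P (i - 1)` whenever a
state `i` is entered. -/
lemma power_eq_of_mem (P : ℕ → ℝ) {k : ℕ} {t : ℝ} (h1 : cleared n τ X S W k ≤ t)
    (h2 : t < cleared n τ X S W (k + 1)) :
    power n P τ X S W t = P 0 + ∑ i ∈ Finset.Icc 1 n,
      (Set.Ico (cleared n τ X S W k + τ i) (arrival X k)).indicator
        (fun _ => P i - P (i - 1)) t := by
  classical
  have hmono := monotone_cleared (X := X) hτ0 hτ hS hW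
  have huniq : ∀ j, cleared n τ X S W j ≤ t ∧ t < arrival X j → j = k := by
    rintro j ⟨h3, h4⟩
    have hle := arrival_le_cleared_succ (X := X) hτ0 hτ hS hW j
    by_contra hne
    rcases lt_or_gt_of_ne hne with h | h
    · have := hmono (show j + 1 ≤ k by omega)
      linarith
    · have := hmono (show k + 1 ≤ j by omega)
      linarith
  by_cases hA : t < arrival X k
  · have hex : ∃ k, cleared n τ X S W k ≤ t ∧ t < arrival X k := ⟨k, h1, hA⟩
    rw [power, dif_pos hex]
    -- stated for every decidability instance, as the definition of `power` uses a classical one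
    have hfind' : ∀ inst, @Nat.find (fun k => cleared n τ X S W k ≤ t ∧ t < arrival X k) inst hex
        = k := fun inst => huniq _ (@Nat.find_spec _ inst hex)
    rw [hfind', power_idle_eq hτ P]
    congr 1
    refine Finset.sum_congr rfl fun i _ => ?_
    simp [Set.indicator, hA, le_sub_iff_add_le']
  · have hex : ¬ ∃ k, cleared n τ X S W k ≤ t ∧ t < arrival X k := by
      rintro ⟨j, hj⟩
      rw [huniq j hj] at hj
      exact hA hj.2
    rw [power, dif_neg hex, Finset.sum_eq_zero, add_zero]
    intro i _
    simp [Set.indicator, hA]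

/-- The energy drawn between two consecutive completion times. -/
lemma integral_power_step (P : ℕ → ℝ) (k : ℕ) :
    ∫ t in cleared n τ X S W k..cleared n τ X S W (k + 1), power n P τ X S W t =
      P 0 * (cleared n τ X S W (k + 1) - cleared n τ X S W k)
        + idleEnergy n P τ (X k - lag n τ X S W k) := by
  have hle := cleared_le_succ (X := X) hτ0 hτ hS hW k
  have hA := arrival_le_cleared_succ (X := X) hτ0 hτ hS hW k
  rw [intervalIntegral.integral_of_le hle, ← integral_Ico_eq_integral_Ioc,
    setIntegral_congr_fun measurableSet_Ico
      fun t ht => power_eq_of_mem (X := X) hτ0 hτ hS hW P ht.1 ht.2]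
  have hi : ∀ i ∈ Finset.Icc 1 n, Integrable
      ((Set.Ico (cleared n τ X S W k + τ i) (arrival X k)).indicator (fun _ => P i - P (i - 1)))
      (volume.restrict (Set.Ico (cleared n τ X S W k) (cleared n τ X S W (k + 1)))) :=
    fun i _ => (integrable_const _).indicator measurableSet_Ico
  rw [integral_add (integrable_const _) (integrable_finsetSum _ hi), integral_finsetSum _ hi,
    setIntegral_const, smul_eq_mul, Real.volume_real_Ico_of_le hle, idleEnergy, mul_comm]
  congr 1
  refine Finset.sum_congr rfl fun i hi => ?_
  have hτi := nonneg_of_mem_Icc hτ0 hτ hi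
  rw [setIntegral_indicator measurableSet_Ico, Set.inter_eq_right.2, setIntegral_const,
    smul_eq_mul, Real.volume_real_Ico, mul_comm, ← arrival_sub_cleared]
  · congr 2; ring
  · exact Set.Ico_subset_Ico (by linarith) hA

end Nonneg

end Path

/-! ### Measurability in the driving sequences -/

section Measurable

variable {n : ℕ} {τ : ℕ → ℝ} (hτ0 : 0 ≤ τ 1) (hτ : StrictMonoOn τ (Set.Icc 1 n))
  {α : Type*} [MeasurableSpace α] {X S : ℕ → α → ℝ} {W : ℕ → ℕ → α → ℝ}

include hτ in
lemma measurable_wakeUp {V : ℕ → α → ℝ} {y : α → ℝ} (hV : ∀ i ∈ Finset.Icc 1 n, Measurable (V i))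
    (hy : Measurable y) : Measurable fun a => wakeUp n τ (fun i => V i a) (y a) := by
  simp_rw [wakeUp_eq_sum hτ]
  exact Finset.measurable_sum _ fun i hi => (hV i hi).mul
    (((measurable_passed n τ i).comp hy).sub ((measurable_passed n τ (i + 1)).comp hy))

include hτ0 hτ

lemma measurable_cleared (k : ℕ) (hX : ∀ j < k, Measurable (X j)) (hS : ∀ j < k, Measurable (S j))
    (hW : ∀ i ∈ Finset.Icc 1 n, ∀ j < k, Measurable (W i j)) :
    Measurable fun a => cleared n τ (fun j => X j a) (fun j => S j a) (fun i j => W i j a) k := by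
  induction k with
  | zero => exact measurable_const
  | succ k ih =>
    have h1 := ih (fun j hj => hX j (by omega)) (fun j hj => hS j (by omega))
      (fun i hi j hj => hW i hi j (by omega))
    have h2 := hX k (by omega)
    have h3 : Measurable fun a =>
        X k a - lag n τ (fun j => X j a) (fun j => S j a) (fun i j => W i j a) k := by
      unfold lag
      exact h2.sub (h1.sub (Finset.measurable_sum _ fun j hj =>
        hX j (by have := Finset.mem_range.1 hj; omega)))
    simp_rw [cleared_succ hτ0 hτ]
    exact ((h1.add (h3.max measurable_const)).add
      (measurable_wakeUp hτ (fun i hi => hW i hi k (by omega)) h3)).add (hS k (by omega))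

lemma measurable_lag (k : ℕ) (hX : ∀ j < k, Measurable (X j)) (hS : ∀ j < k, Measurable (S j))
    (hW : ∀ i ∈ Finset.Icc 1 n, ∀ j < k, Measurable (W i j)) :
    Measurable fun a => lag n τ (fun j => X j a) (fun j => S j a) (fun i j => W i j a) k := by
  unfold lag
  exact (measurable_cleared hτ0 hτ k hX hS hW).sub
    (Finset.measurable_sum _ fun j hj => hX j (Finset.mem_range.1 hj))

/-- The power is jointly measurable in the driving sequences and in time. -/
lemma measurable_power (P : ℕ → ℝ) {t : α → ℝ} (ht : Measurable t) (hX : ∀ j, Measurable (X j))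
    (hS : ∀ j, Measurable (S j)) (hW : ∀ i ∈ Finset.Icc 1 n, ∀ j, Measurable (W i j)) :
    Measurable fun a =>
      power n P τ (fun j => X j a) (fun j => S j a) (fun i j => W i j a) (t a) := by
  classical
  let C : ℕ → α → ℝ := fun k a =>
    cleared n τ (fun j => X j a) (fun j => S j a) (fun i j => W i j a) k
  have hC : ∀ k, Measurable (C k) := fun k =>
    measurable_cleared hτ0 hτ k (fun j _ => hX j) (fun j _ => hS j) (fun i hi j _ => hW i hi j)
  have hA : ∀ k, Measurable fun a => arrival (fun j => X j a) k := fun k =>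
    Finset.measurable_sum _ fun j _ => hX j
  let p : ℕ → α → Prop := fun k a => C k a ≤ t a ∧ t a < arrival (fun j => X j a) k
  have hp : ∀ k, MeasurableSet {a | p k a} := fun k =>
    (measurableSet_le (hC k) ht).inter (measurableSet_lt ht (hA k))
  have hf : ∀ k, Measurable fun a => P (idleState n τ (t a - C k a)) := by
    intro k
    simp_rw [power_idle_eq hτ P]
    refine measurable_const.add (Finset.measurable_sum _ fun i _ => ?_)
    exact Measurable.ite (measurableSet_le measurable_const (ht.sub (hC k))) measurable_const
      measurable_const
  intro s hs
  have e : (fun a => power n P τ (fun j => X j a) (fun j => S j a) (fun i j => W i j a) (t a)) ⁻¹' s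
      = (⋃ k, {a | (p k a ∧ ∀ j < k, ¬ p j a) ∧ P (idleState n τ (t a - C k a)) ∈ s}) ∪
        {a | (∀ k, ¬ p k a) ∧ P 0 ∈ s} := by
    ext a
    simp only [Set.mem_preimage, Set.mem_union, Set.mem_iUnion, Set.mem_ofPred_eq]
    by_cases h : ∃ k, p k a
    · have hfind : ∀ k, (p k a ∧ ∀ j < k, ¬ p j a) ↔ Nat.find h = k := fun k =>
        (Nat.find_eq_iff h).symm
      have hno : ¬ ∀ k, ¬ p k a := by push Not; exact h
      simp only [hfind, hno, false_and, or_false, exists_eq_left']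
      rw [power, dif_pos h]
    · have hno : ∀ k, ¬ p k a := not_exists.1 h
      rw [power, dif_neg h]
      simp [hno]
  rw [e]
  have hfirst : ∀ k, MeasurableSet {a | ∀ j < k, ¬ p j a} := fun k => by
    have : {a | ∀ j < k, ¬ p j a} = ⋂ j, ⋂ _ : j < k, {a | p j a}ᶜ := by ext; simp
    rw [this]
    exact MeasurableSet.iInter fun j => MeasurableSet.iInter fun _ => (hp j).compl
  have hnone : MeasurableSet {a | ∀ k, ¬ p k a} := by
    have : {a | ∀ k, ¬ p k a} = ⋂ k, {a | p k a}ᶜ := by ext; simp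
    rw [this]
    exact MeasurableSet.iInter fun j => (hp j).compl
  exact (MeasurableSet.iUnion fun k => ((hp k).inter (hfirst k)).inter (hf k hs)).union
    (hnone.inter (MeasurableSet.const _))

end Measurable

/-! ### The closed forms -/

/-- `stateSum` is the mean of `a` over the state in which an exponential idle period ends. -/
lemma stateSum_eq (lam : ℝ) {n : ℕ} (hn : 1 ≤ n) (τ a : ℕ → ℝ) :
    stateSum lam n τ a =
      ∑ i ∈ Finset.Icc 1 n, a i * (passedMean lam n τ i - passedMean lam n τ (i + 1)) := by
  rw [← Finset.Ico_add_one_right_eq_Icc, Finset.sum_Ico_succ_top hn, stateSum]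
  congr 1
  · refine Finset.sum_congr rfl fun i hi => ?_
    rw [Finset.mem_Ico] at hi
    rw [passedMean, passedMean, if_pos (by omega), if_pos (by omega)]
  · simp [passedMean]

/-- Summation by parts. -/
lemma sum_increments_eq_stateSum (lam : ℝ) {n : ℕ} (hn : 1 ≤ n) (τ a : ℕ → ℝ) :
    ∑ i ∈ Finset.Icc 1 n, (a i - a (i - 1)) * Real.exp (-lam * τ i) =
      stateSum lam n τ a - a 0 * Real.exp (-lam * τ 1) := by
  induction n, hn using Nat.le_induction with
  | base => simp [stateSum]; ring
  | succ n hn ih =>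
    rw [Finset.sum_Icc_succ_top (by omega), ih, stateSum, stateSum, Finset.sum_Ico_succ_top hn]
    simp only [Nat.add_sub_cancel]
    ring

/-! ### Deterministic averages -/

lemma tendsto_succ_div {a : ℕ → ℝ} {l : ℝ} (h : Tendsto (fun N : ℕ => a N / N) atTop (𝓝 l)) :
    Tendsto (fun N : ℕ => a (N + 1) / N) atTop (𝓝 l) := by
  have h1 := h.comp (tendsto_add_atTop_nat 1)
  have h2 : Tendsto (fun N : ℕ => 1 + 1 / (N : ℝ)) atTop (𝓝 (1 + 0)) :=
    tendsto_one_div_atTop_nhds_zero_nat.const_add 1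
  have h3 := h1.mul h2
  rw [add_zero, mul_one] at h3
  refine h3.congr' ?_
  filter_upwards [eventually_ge_atTop 1] with N hN
  have : (0 : ℝ) < N := by exact_mod_cast hN
  simp only [Function.comp]
  push_cast
  field_simp

lemma tendsto_term_div {v : ℕ → ℝ} {l : ℝ}
    (h : Tendsto (fun N : ℕ => (∑ k ∈ Finset.range N, v k) / N) atTop (𝓝 l)) :
    Tendsto (fun N : ℕ => v N / N) atTop (𝓝 0) := by
  have h1 := (tendsto_succ_div h).sub h
  rw [sub_self] at h1
  refine h1.congr fun N => ?_
  rw [Finset.sum_range_succ]; ring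

lemma exists_le_of_tendsto_div {a : ℕ → ℝ} (h : Tendsto (fun N : ℕ => a N / N) atTop (𝓝 0))
    {ε : ℝ} (hε : 0 < ε) : ∃ K, ∀ k N : ℕ, k ≤ N → a k ≤ ε * N + K := by
  obtain ⟨k0, hk0⟩ := ((tendsto_order.1 h).2 ε hε).exists_forall_of_atTop
  refine ⟨∑ j ∈ Finset.range (k0 + 1), |a j|, fun k N hkN => ?_⟩
  have hNk : (k : ℝ) ≤ N := by exact_mod_cast hkN
  have hs : 0 ≤ ∑ j ∈ Finset.range (k0 + 1), |a j| := Finset.sum_nonneg fun _ _ => abs_nonneg _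
  rcases le_or_gt k k0 with h1 | h1
  · have := Finset.single_le_sum (f := fun j => |a j|) (fun _ _ => abs_nonneg _)
      (Finset.mem_range.2 (show k < k0 + 1 by omega))
    have h2 := le_abs_self (a k)
    have : 0 ≤ ε * N := by positivity
    linarith
  · have hk : (0 : ℝ) < k := by exact_mod_cast (by omega : 0 < k)
    have h2 := hk0 k h1.le
    rw [div_lt_iff₀ hk] at h2
    have : ε * k ≤ ε * N := by gcongr
    linarith

/-- Inversion of a sequence of epochs: if `C N` grows like `c * N`, and `G` is Lipschitz between the
epochs and grows like `l * N` along them, then `G T` grows like `l / c * T`. -/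
lemma tendsto_div_of_tendsto_epochs {C : ℕ → ℝ} (hmono : Monotone C) (h0 : C 0 = 0) {c : ℝ}
    (hc : 0 < c) (hC : Tendsto (fun N : ℕ => C N / N) atTop (𝓝 c)) {G : ℝ → ℝ} {K l : ℝ}
    (hG : ∀ N T, C N ≤ T → |G T - G (C N)| ≤ K * (T - C N))
    (hl : Tendsto (fun N : ℕ => G (C N) / N) atTop (𝓝 l)) :
    Tendsto (fun T => G T / T) atTop (𝓝 (l / c)) := by
  have hCtop : Tendsto C atTop atTop := by
    have := hC.pos_mul_atTop hc tendsto_natCast_atTop_atTop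
    refine this.congr' ?_
    filter_upwards [eventually_ge_atTop 1] with N hN
    have : (0 : ℝ) < N := by exact_mod_cast hN
    field_simp
  have hex : ∀ T : ℝ, ∃ N, 0 ≤ T → C N ≤ T ∧ T < C (N + 1) := by
    intro T
    have h1 : ∃ N, T < C N := (hCtop.eventually_gt_atTop T).exists
    classical
    refine ⟨Nat.find h1 - 1, fun hT => ?_⟩
    have h2 : Nat.find h1 ≠ 0 := fun h => by
      have := Nat.find_spec h1
      rw [h, h0] at this
      linarith
    refine ⟨not_lt.1 (Nat.find_min h1 (by omega)), ?_⟩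
    rw [Nat.sub_add_cancel (by omega)]
    exact Nat.find_spec h1
  choose f hf using hex
  have hftop : Tendsto f atTop atTop := by
    refine tendsto_atTop.2 fun b => ?_
    filter_upwards [eventually_ge_atTop 0, eventually_ge_atTop (C b)] with T hT hb
    by_contra hlt
    have := hmono (show f T + 1 ≤ b by omega)
    linarith [(hf T hT).2]
  have hCf := hC.comp hftop
  have hTf : Tendsto (fun T => T / (f T : ℝ)) atTop (𝓝 c) := by
    refine tendsto_of_tendsto_of_tendsto_of_le_of_le' hCf ((tendsto_succ_div hC).comp hftop) ?_ ?_
    · filter_upwards [eventually_ge_atTop 0] with T hT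
      exact div_le_div_of_nonneg_right (hf T hT).1 (Nat.cast_nonneg _)
    · filter_upwards [eventually_ge_atTop 0] with T hT
      exact div_le_div_of_nonneg_right (hf T hT).2.le (Nat.cast_nonneg _)
  have hrem : Tendsto (fun T => (G T - G (C (f T))) / f T) atTop (𝓝 0) := by
    have h1 : Tendsto (fun T => K * (T / (f T : ℝ) - C (f T) / f T)) atTop (𝓝 0) := by
      simpa using (hTf.sub hCf).const_mul K
    refine squeeze_zero_norm' ?_ h1
    filter_upwards [eventually_ge_atTop 0] with T hT
    rw [Real.norm_eq_abs, abs_div, Nat.abs_cast, ← sub_div, ← mul_div_assoc]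
    exact div_le_div_of_nonneg_right (hG _ _ (hf T hT).1) (Nat.cast_nonneg _)
  have hGf : Tendsto (fun T => G T / (f T : ℝ)) atTop (𝓝 l) := by
    have := (hl.comp hftop).add hrem
    rw [add_zero] at this
    refine this.congr fun T => ?_
    simp only [Function.comp]
    ring
  refine (hGf.div hTf hc.ne').congr' ?_
  filter_upwards [hftop.eventually_ge_atTop 1] with T hT
  have : (0 : ℝ) < f T := by exact_mod_cast hT
  simp only [Pi.div_apply]
  field_simp

section Path

variable {n : ℕ} {τ : ℕ → ℝ} (hτ0 : 0 ≤ τ 1) (hτ : StrictMonoOn τ (Set.Icc 1 n))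
  {X S : ℕ → ℝ} {W : ℕ → ℕ → ℝ} (hX : ∀ k, 0 ≤ X k) (hS : ∀ k, 0 ≤ S k)
  (hW : ∀ i ∈ Finset.Icc 1 n, ∀ k, 0 ≤ W i k)

include hτ0 hτ hX hS hW

/-- Stability: as jobs are served at least as fast as they arrive, the backlog is sublinear. Since
the last job that found the system empty, the backlog has changed by the difference of a service and
an arrival sum, whose drift is not positive and whose deviations from the drift are sublinear. -/
lemma tendsto_lag_div {x s : ℝ} {w : ℕ → ℝ} (hsx : s ≤ x)
    (hXlim : Tendsto (fun N : ℕ => (∑ k ∈ Finset.range N, X k) / N) atTop (𝓝 x))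
    (hSlim : Tendsto (fun N : ℕ => (∑ k ∈ Finset.range N, S k) / N) atTop (𝓝 s))
    (hWlim : ∀ i ∈ Finset.Icc 1 n,
      Tendsto (fun N : ℕ => (∑ k ∈ Finset.range N, W i k) / N) atTop (𝓝 (w i))) :
    Tendsto (fun N : ℕ => lag n τ X S W N / N) atTop (𝓝 0) := by
  have dev : ∀ {v : ℕ → ℝ} {l : ℝ}, Tendsto (fun N : ℕ => v N / N) atTop (𝓝 l) →
      Tendsto (fun N : ℕ => |v N - l * N| / N) atTop (𝓝 0) := by
    intro v l h
    have h1 : Tendsto (fun N : ℕ => |v N / N - l|) atTop (𝓝 0) := by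
      simpa using (h.sub_const l).abs
    refine h1.congr' ?_
    filter_upwards [eventually_ge_atTop 1] with N hN
    have : (0 : ℝ) < N := by exact_mod_cast hN
    rw [← abs_of_pos this, ← abs_div, abs_of_pos this]
    congr 1
    field_simp
  -- collects all deviations; it is sublinear, so `b k ≤ ε * N + K` for all `k ≤ N`
  let b : ℕ → ℝ := fun k => ∑ i ∈ Finset.Icc 1 n, W i k
    + |∑ j ∈ Finset.range k, S j - s * k| + |∑ j ∈ Finset.range k, X j - x * k|
  have hb : Tendsto (fun N : ℕ => b N / N) atTop (𝓝 0) := by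
    have h1 : Tendsto (fun N : ℕ => ∑ i ∈ Finset.Icc 1 n, W i N / N) atTop
        (𝓝 (∑ i ∈ Finset.Icc 1 n, 0)) :=
      tendsto_finsetSum _ fun i hi => tendsto_term_div (hWlim i hi)
    have h2 := (h1.add (dev hSlim)).add (dev hXlim)
    simp only [Finset.sum_const_zero, add_zero] at h2
    refine h2.congr fun N => ?_
    simp only [b]
    rw [add_div, add_div, Finset.sum_div]
  have hb0 : ∀ k, |∑ j ∈ Finset.range k, X j - x * k| ≤ b k ∧
      ∑ i ∈ Finset.Icc 1 n, W i k + |∑ j ∈ Finset.range k, S j - s * k| ≤ b k ∧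
      |∑ j ∈ Finset.range k, S j - s * k| + |∑ j ∈ Finset.range k, X j - x * k| ≤ b k := by
    intro k
    have h1 : 0 ≤ ∑ i ∈ Finset.Icc 1 n, W i k := Finset.sum_nonneg fun i hi => hW i hi k
    have h2 := abs_nonneg (∑ j ∈ Finset.range k, S j - s * k)
    have h3 := abs_nonneg (∑ j ∈ Finset.range k, X j - x * k)
    simp only [b]
    refine ⟨?_, ?_, ?_⟩ <;> linarith
  rw [tendsto_order]
  refine ⟨fun a ha => Eventually.of_forall fun N => ha.trans_le
    (div_nonneg (lag_nonneg hτ0 hτ hS hW N) (Nat.cast_nonneg _)), fun a ha => ?_⟩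
  obtain ⟨K, hK⟩ := exists_le_of_tendsto_div hb (show 0 < a / 6 by linarith)
  have hbig : ∀ᶠ N : ℕ in atTop, (s + 3 * K) / (N : ℝ) < a / 2 :=
    (tendsto_order.1 (tendsto_const_div_atTop_nhds_zero_nat (s + 3 * K))).2 _ (by linarith)
  filter_upwards [hbig, eventually_ge_atTop 1] with N hN hN1
  obtain ⟨M, rfl⟩ : ∃ M, N = M + 1 := ⟨N - 1, by omega⟩
  have hp : (0 : ℝ) < ((M + 1 : ℕ) : ℝ) := by positivity
  obtain ⟨k, hk, hle⟩ := exists_lag_eq hτ0 hτ hW hX (S := S) M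
  rw [Finset.sum_Ico_eq_sub _ (by omega), Finset.sum_Ico_eq_sub _ (by omega)] at hle
  have e1 := hK k (M + 1) (by omega)
  have e2 := hK (k + 1) (M + 1) (by omega)
  have e3 := hK (M + 1) (M + 1) le_rfl
  have f1 := (hb0 k).2.1
  have f2 := (hb0 (k + 1)).1
  have f3 := (hb0 (M + 1)).2.2
  have g1 := neg_abs_le (∑ j ∈ Finset.range k, S j - s * k)
  have g2 := le_abs_self (∑ j ∈ Finset.range (k + 1), X j - x * ((k + 1 : ℕ) : ℝ))
  have g3 := le_abs_self (∑ j ∈ Finset.range (M + 1), S j - s * ((M + 1 : ℕ) : ℝ))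
  have g4 := neg_abs_le (∑ j ∈ Finset.range (M + 1), X j - x * ((M + 1 : ℕ) : ℝ))
  have hkM : (k : ℝ) ≤ M := by exact_mod_cast hk
  have hdrift : s * ((M : ℝ) - k) ≤ x * (M - k) :=
    mul_le_mul_of_nonneg_right hsx (by linarith)
  have hle2 : lag n τ X S W (M + 1) ≤ s + 3 * (a / 6 * ((M + 1 : ℕ) : ℝ) + K) := by
    push_cast at *
    linarith
  rw [div_lt_iff₀ hp] at hN ⊢
  linarith

/-- The fraction `p` of jobs that find the system empty is determined by the balance of time: the
idle periods, the wake-ups and the services fill the whole time axis. -/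
lemma tendsto_empty_fraction {x s V : ℝ} {w : ℕ → ℝ} (hsx : s ≤ x) (hxV : 0 < x + V)
    (hXlim : Tendsto (fun N : ℕ => (∑ k ∈ Finset.range N, X k) / N) atTop (𝓝 x))
    (hSlim : Tendsto (fun N : ℕ => (∑ k ∈ Finset.range N, S k) / N) atTop (𝓝 s))
    (hWlim : ∀ i ∈ Finset.Icc 1 n,
      Tendsto (fun N : ℕ => (∑ k ∈ Finset.range N, W i k) / N) atTop (𝓝 (w i)))
    (hI : Tendsto (fun N : ℕ => (∑ k ∈ Finset.range N, (max (X k - lag n τ X S W k) 0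
      - x * if 0 ≤ X k - lag n τ X S W k then 1 else 0)) / N) atTop (𝓝 0))
    (hV : Tendsto (fun N : ℕ => (∑ k ∈ Finset.range N,
      (wakeUp n τ (fun i => W i k) (X k - lag n τ X S W k)
        - V * if 0 ≤ X k - lag n τ X S W k then 1 else 0)) / N) atTop (𝓝 0)) :
    Tendsto (fun N : ℕ => cleared n τ X S W N / N) atTop (𝓝 x) ∧
    Tendsto (fun N : ℕ => (∑ k ∈ Finset.range N,
      if 0 ≤ X k - lag n τ X S W k then (1 : ℝ) else 0) / N) atTop (𝓝 ((x - s) / (x + V))) := by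
  have hC : Tendsto (fun N : ℕ => cleared n τ X S W N / N) atTop (𝓝 x) := by
    have := (tendsto_lag_div hτ0 hτ hX hS hW hsx hXlim hSlim hWlim).add hXlim
    rw [zero_add] at this
    refine this.congr fun N => ?_
    rw [← add_div, lag]
    ring
  refine ⟨hC, ?_⟩
  have h1 := ((((hC.sub hSlim).sub hI).sub hV).div_const (x + V))
  simp only [sub_zero] at h1
  refine h1.congr fun N => ?_
  rw [cleared_eq_sum hτ0 hτ, Finset.sum_sub_distrib, Finset.sum_sub_distrib, ← Finset.mul_sum,
    ← Finset.mul_sum]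
  field_simp
  ring

omit hX in
/-- Along a sample path that obeys the laws of large numbers, the average power converges. -/
lemma tendsto_average_power (P : ℕ → ℝ) {x l : ℝ} (hx : 0 < x)
    (hC : Tendsto (fun N : ℕ => cleared n τ X S W N / N) atTop (𝓝 x))
    (hl : Tendsto (fun N : ℕ =>
      (∑ k ∈ Finset.range N, idleEnergy n P τ (X k - lag n τ X S W k)) / N) atTop (𝓝 l)) :
    Tendsto (fun T : ℝ => (∫ t in (0 : ℝ)..T, power n P τ X S W t) / T) atTop
      (𝓝 (P 0 + l / x)) := by
  have hmeas : Measurable (power n P τ X S W) :=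
    measurable_power hτ0 hτ P (α := ℝ) (X := fun j _ => X j) (S := fun j _ => S j)
      (W := fun i j _ => W i j) measurable_id (fun _ => measurable_const)
      (fun _ => measurable_const) (fun _ _ _ => measurable_const)
  set K := ∑ i ∈ Finset.range (n + 1), |P i|
  have hint : ∀ a b, IntervalIntegrable (power n P τ X S W) volume a b := fun a b =>
    (intervalIntegrable_const (c := K)).mono_fun' hmeas.aestronglyMeasurable
      (Eventually.of_forall fun t => abs_power_le P t)
  have hepoch : ∀ N, ∫ t in (0 : ℝ)..cleared n τ X S W N, power n P τ X S W t =
      P 0 * cleared n τ X S W N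
        + ∑ k ∈ Finset.range N, idleEnergy n P τ (X k - lag n τ X S W k) := by
    intro N
    induction N with
    | zero => simp [cleared]
    | succ N ih =>
      rw [← intervalIntegral.integral_add_adjacent_intervals (hint 0 (cleared n τ X S W N))
        (hint _ _), ih, integral_power_step hτ0 hτ hS hW, Finset.sum_range_succ]
      ring
  have hlip : ∀ N T, cleared n τ X S W N ≤ T →
      |(∫ t in (0 : ℝ)..T, power n P τ X S W t)
        - ∫ t in (0 : ℝ)..cleared n τ X S W N, power n P τ X S W t|
        ≤ K * (T - cleared n τ X S W N) := by
    intro N T hT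
    rw [intervalIntegral.integral_interval_sub_left (hint _ _) (hint _ _)]
    have := intervalIntegral.norm_integral_le_of_norm_le_const (a := cleared n τ X S W N) (b := T)
      (f := power n P τ X S W) (C := K) fun t _ => abs_power_le P t
    rwa [abs_of_nonneg (sub_nonneg.2 hT)] at this
  have hlim : Tendsto (fun N : ℕ =>
      (∫ t in (0 : ℝ)..cleared n τ X S W N, power n P τ X S W t) / N) atTop
      (𝓝 (P 0 * x + l)) := by
    refine ((hC.const_mul (P 0)).add hl).congr fun N => ?_
    rw [hepoch]
    ring
  have := tendsto_div_of_tendsto_epochs (monotone_cleared (X := X) hτ0 hτ hS hW) rfl hx hC hlip hlim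
  rwa [add_div, mul_div_cancel_right₀ _ hx.ne'] at this

end Path

/-! ### The random queue -/

section Past

variable {Ω : Type*} {n : ℕ}

/-- All driving variables as one family. -/
def driving (n : ℕ) (X S : ℕ → Ω → ℝ) (W : ℕ → ℕ → Ω → ℝ) :
    ℕ ⊕ (ℕ ⊕ (Finset.Icc 1 n × ℕ)) → Ω → ℝ :=
  Sum.elim X (Sum.elim S (fun p : Finset.Icc 1 n × ℕ => W p.1 p.2))

/-- The order in which the driving variables are revealed: for each job its inter-arrival time, then
its wake-up latencies, then its service time. -/
def stamp (n : ℕ) : ℕ ⊕ (ℕ ⊕ (Finset.Icc 1 n × ℕ)) → ℕ :=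
  Sum.elim (fun k => 3 * k) (Sum.elim (fun k => 3 * k + 2) (fun p => 3 * p.2 + 1))

/-- The information carried by the driving variables revealed before stage `t`. -/
@[reducible] def past (n : ℕ) (X S : ℕ → Ω → ℝ) (W : ℕ → ℕ → Ω → ℝ) (t : ℕ) : MeasurableSpace Ω :=
  ⨆ a ∈ {a | stamp n a < t}, MeasurableSpace.comap (driving n X S W a) inferInstance

variable {X S : ℕ → Ω → ℝ} {W : ℕ → ℕ → Ω → ℝ}

lemma measurable_driving_past {t : ℕ} {a : ℕ ⊕ (ℕ ⊕ (Finset.Icc 1 n × ℕ))} (ha : stamp n a < t) :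
    Measurable[past n X S W t] (driving n X S W a) :=
  measurable_iff_comap_le.2 (le_iSup₂_of_le a ha le_rfl)

lemma past_mono {s t : ℕ} (h : s ≤ t) : past n X S W s ≤ past n X S W t :=
  biSup_mono fun _ (ha : _ < s) => ha.trans_le h

lemma measurable_interarrival_past {t k : ℕ} (h : 3 * k < t) : Measurable[past n X S W t] (X k) :=
  measurable_driving_past (a := Sum.inl k) h

lemma measurable_service_past {t k : ℕ} (h : 3 * k + 2 < t) : Measurable[past n X S W t] (S k) :=
  measurable_driving_past (a := Sum.inr (Sum.inl k)) h

lemma measurable_latency_past {t i k : ℕ} (hi : i ∈ Finset.Icc 1 n) (h : 3 * k + 1 < t) :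
    Measurable[past n X S W t] (W i k) :=
  measurable_driving_past (a := Sum.inr (Sum.inr (⟨i, hi⟩, k))) h

lemma indepFun_driving_of_past [MeasurableSpace Ω] {Pr : Measure Ω}
    (hind : iIndepFun (driving n X S W) Pr) (hm : ∀ a, Measurable (driving n X S W a)) {t : ℕ}
    {β : Type*} [MeasurableSpace β] {U : Ω → β} (hU : Measurable[past n X S W t] U)
    {a : ℕ ⊕ (ℕ ⊕ (Finset.Icc 1 n × ℕ))} (ha : t ≤ stamp n a) :
    IndepFun U (driving n X S W a) Pr := by
  have hdisj : Disjoint {a | stamp n a < t} {a | t ≤ stamp n a} :=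
    Set.disjoint_left.2 fun b (hb : _ < t) (hb' : t ≤ _) => absurd hb (not_lt.2 hb')
  have h := indep_iSup_of_disjoint (fun a => (hm a).comap_le) hind.iIndep hdisj
  rw [IndepFun_iff_Indep]
  refine indep_of_indep_of_le_left (indep_of_indep_of_le_right h ?_) hU.comap_le
  exact le_iSup₂_of_le a ha le_rfl

end Past

/-- The length of the idle period that job `k` ends, if this is non-negative; otherwise job `k` has
to queue. -/
noncomputable def excess {Ω : Type*} (n : ℕ) (τ : ℕ → ℝ) (X S : ℕ → Ω → ℝ) (W : ℕ → ℕ → Ω → ℝ)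
    (k : ℕ) (ω : Ω) : ℝ :=
  X k ω - lag n τ (fun j => X j ω) (fun j => S j ω) (fun i j => W i j ω) k

/-- The assumptions on the queue: `lam` is the arrival rate, `r` the service rate, and `w i` the
mean wake-up latency from state `i`. -/
structure IsSleepQueue {Ω : Type*} [MeasurableSpace Ω] (Pr : Measure Ω) (lam r : ℝ) (n : ℕ)
    (τ w : ℕ → ℝ) (X S : ℕ → Ω → ℝ) (W : ℕ → ℕ → Ω → ℝ) : Prop where
  lam_pos : 0 < lam
  stable : lam < r
  tau_nonneg : 0 ≤ τ 1
  tau_mono : StrictMonoOn τ (Set.Icc 1 n)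
  X_meas : ∀ k, Measurable (X k)
  S_meas : ∀ k, Measurable (S k)
  W_meas : ∀ i ∈ Finset.Icc 1 n, ∀ k, Measurable (W i k)
  X_law : ∀ k, Pr.map (X k) = expMeasure lam
  S_law : ∀ k, Pr.map (S k) = expMeasure r
  W_nonneg : ∀ i ∈ Finset.Icc 1 n, ∀ k, ∀ᵐ ω ∂Pr, 0 ≤ W i k ω
  W_int : ∀ i ∈ Finset.Icc 1 n, Integrable (W i 0) Pr
  W_mean : ∀ i ∈ Finset.Icc 1 n, ∫ ω, W i 0 ω ∂Pr = w i
  W_ident : ∀ i ∈ Finset.Icc 1 n, ∀ k, IdentDistrib (W i k) (W i 0) Pr Pr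
  indep : iIndepFun (driving n X S W) Pr

namespace IsSleepQueue

variable {Ω : Type*} [MeasurableSpace Ω] {Pr : Measure Ω} {lam r : ℝ}
  {n : ℕ} {τ w : ℕ → ℝ} {X S : ℕ → Ω → ℝ} {W : ℕ → ℕ → Ω → ℝ}
  (Q : IsSleepQueue Pr lam r n τ w X S W)

include Q

lemma r_pos : 0 < r := Q.lam_pos.trans Q.stable

lemma measurable_driving (a : ℕ ⊕ (ℕ ⊕ (Finset.Icc 1 n × ℕ))) : Measurable (driving n X S W a) := by
  rcases a with k | k | ⟨i, k⟩
  · exact Q.X_meas k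
  · exact Q.S_meas k
  · exact Q.W_meas i i.2 k

lemma past_le (t : ℕ) : past n X S W t ≤ ‹MeasurableSpace Ω› :=
  iSup₂_le fun a _ => (Q.measurable_driving a).comap_le

section Indep

variable {β : Type*} [MeasurableSpace β] {U : Ω → β} {k : ℕ}

lemma indepFun_X (hU : Measurable[past n X S W (3 * k)] U) : IndepFun U (X k) Pr :=
  indepFun_driving_of_past Q.indep Q.measurable_driving hU (a := Sum.inl k) le_rfl

lemma indepFun_W {i : ℕ} (hi : i ∈ Finset.Icc 1 n) (hU : Measurable[past n X S W (3 * k + 1)] U) :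
    IndepFun U (W i k) Pr :=
  indepFun_driving_of_past Q.indep Q.measurable_driving hU
    (a := Sum.inr (Sum.inr (⟨i, hi⟩, k))) le_rfl

lemma indepFun_S (hU : Measurable[past n X S W (3 * k + 2)] U) : IndepFun U (S k) Pr :=
  indepFun_driving_of_past Q.indep Q.measurable_driving hU (a := Sum.inr (Sum.inl k)) le_rfl

lemma measurable_lag_past (k : ℕ) : Measurable[past n X S W (3 * k)] fun ω =>
    lag n τ (fun j => X j ω) (fun j => S j ω) (fun i j => W i j ω) k :=
  @measurable_lag n τ Q.tau_nonneg Q.tau_mono Ω (past n X S W (3 * k)) X S W k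
    (fun _ _ => measurable_interarrival_past (by omega))
    (fun _ _ => measurable_service_past (by omega))
    (fun _ hi _ _ => measurable_latency_past hi (by omega))

lemma measurable_excess_past {k t : ℕ} (h : 3 * k < t) :
    Measurable[past n X S W t] (excess n τ X S W k) :=
  (measurable_interarrival_past h).sub ((Q.measurable_lag_past k).mono (past_mono h.le) le_rfl)

lemma measurable_excess (k : ℕ) : Measurable (excess n τ X S W k) :=
  (Q.measurable_excess_past (Nat.lt_succ_self _)).mono (Q.past_le _) le_rfl

lemma measurable_passed_diff {k i t : ℕ} (h : 3 * k < t) : Measurable[past n X S W t] fun ω =>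
    passed n τ i (excess n τ X S W k ω) - passed n τ (i + 1) (excess n τ X S W k ω) :=
  ((measurable_passed n τ i).comp (Q.measurable_excess_past h)).sub
    ((measurable_passed n τ (i + 1)).comp (Q.measurable_excess_past h))

end Indep

lemma ae_nonneg : ∀ᵐ ω ∂Pr, (∀ k, 0 ≤ X k ω) ∧ (∀ k, 0 ≤ S k ω) ∧
    ∀ i ∈ Finset.Icc 1 n, ∀ k, 0 ≤ W i k ω := by
  have hX : ∀ k, ∀ᵐ ω ∂Pr, 0 ≤ X k ω := fun k =>
    ae_of_ae_map (Q.X_meas k).aemeasurable (by rw [Q.X_law]; exact ae_nonneg_expMeasure lam)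
  have hS : ∀ k, ∀ᵐ ω ∂Pr, 0 ≤ S k ω := fun k =>
    ae_of_ae_map (Q.S_meas k).aemeasurable (by rw [Q.S_law]; exact ae_nonneg_expMeasure r)
  have hW : ∀ᵐ ω ∂Pr, ∀ i ∈ Finset.Icc 1 n, ∀ k, 0 ≤ W i k ω := by
    rw [Filter.eventually_all_finset]
    exact fun i hi => ae_all_iff.2 (Q.W_nonneg i hi)
  filter_upwards [ae_all_iff.2 hX, ae_all_iff.2 hS, hW] with ω h1 h2 h3
  exact ⟨h1, h2, h3⟩

lemma ae_lag_nonneg (k : ℕ) : ∀ᵐ ω ∂Pr,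
    0 ≤ lag n τ (fun j => X j ω) (fun j => S j ω) (fun i j => W i j ω) k := by
  filter_upwards [Q.ae_nonneg] with ω hω
  exact lag_nonneg Q.tau_nonneg Q.tau_mono hω.2.1 hω.2.2 k

lemma integrable_X (k : ℕ) : Integrable (X k) Pr := by
  have := isProbabilityMeasure_expMeasure Q.lam_pos
  have h : Integrable (fun x : ℝ => x) (Pr.map (X k)) := by
    rw [Q.X_law]; exact (memLp_two_id_expMeasure Q.lam_pos).integrable (by norm_num)
  exact h.comp_measurable (Q.X_meas k)

lemma integrable_S (k : ℕ) : Integrable (S k) Pr := by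
  have := isProbabilityMeasure_expMeasure Q.r_pos
  have h : Integrable (fun x : ℝ => x) (Pr.map (S k)) := by
    rw [Q.S_law]; exact (memLp_two_id_expMeasure Q.r_pos).integrable (by norm_num)
  exact h.comp_measurable (Q.S_meas k)

lemma integral_X (k : ℕ) : ∫ ω, X k ω ∂Pr = 1 / lam := by
  rw [← integral_id_expMeasure Q.lam_pos, ← Q.X_law k,
    integral_map (Q.X_meas k).aemeasurable (by fun_prop)]

lemma integral_S (k : ℕ) : ∫ ω, S k ω ∂Pr = 1 / r := by
  rw [← integral_id_expMeasure Q.r_pos, ← Q.S_law k,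
    integral_map (Q.S_meas k).aemeasurable (by fun_prop)]

lemma strong_law_X : ∀ᵐ ω ∂Pr,
    Tendsto (fun N : ℕ => (∑ k ∈ Finset.range N, X k ω) / N) atTop (𝓝 (1 / lam)) := by
  rw [← Q.integral_X 0]
  refine strong_law_ae_real X (Q.integrable_X 0) (fun j k hjk => ?_) fun k =>
    ⟨(Q.X_meas k).aemeasurable, (Q.X_meas 0).aemeasurable, by rw [Q.X_law, Q.X_law]⟩
  exact Q.indep.indepFun (i := Sum.inl j) (j := Sum.inl k) (by simpa using hjk)

lemma strong_law_S : ∀ᵐ ω ∂Pr,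
    Tendsto (fun N : ℕ => (∑ k ∈ Finset.range N, S k ω) / N) atTop (𝓝 (1 / r)) := by
  rw [← Q.integral_S 0]
  refine strong_law_ae_real S (Q.integrable_S 0) (fun j k hjk => ?_) fun k =>
    ⟨(Q.S_meas k).aemeasurable, (Q.S_meas 0).aemeasurable, by rw [Q.S_law, Q.S_law]⟩
  exact Q.indep.indepFun (i := Sum.inr (Sum.inl j)) (j := Sum.inr (Sum.inl k)) (by simpa using hjk)

lemma strong_law_W {i : ℕ} (hi : i ∈ Finset.Icc 1 n) : ∀ᵐ ω ∂Pr,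
    Tendsto (fun N : ℕ => (∑ k ∈ Finset.range N, W i k ω) / N) atTop (𝓝 (w i)) := by
  rw [← Q.W_mean i hi]
  refine strong_law_ae_real (W i) (Q.W_int i hi) (fun j k hjk => ?_) (Q.W_ident i hi)
  exact Q.indep.indepFun (i := Sum.inr (Sum.inr (⟨i, hi⟩, j)))
    (j := Sum.inr (Sum.inr (⟨i, hi⟩, k))) (by simpa using hjk)

/-- The law of large numbers for functionals of the idle periods with mean zero. -/
lemma strong_law_comp_excess [IsProbabilityMeasure Pr] {h : ℝ → ℝ} (hh : Measurable h)
    (h0 : ∀ y < 0, h y = 0) (hmean : ∫ x, h x ∂expMeasure lam = 0) {c : ℝ} (hc : 0 ≤ c)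
    (hbound : ∀ y, 0 ≤ y → |h y| ≤ y + c) : ∀ᵐ ω ∂Pr, Tendsto (fun N : ℕ =>
      (∑ k ∈ Finset.range N, h (excess n τ X S W k ω)) / N) atTop (𝓝 0) := by
  refine strong_law_excess Q.lam_pos Q.X_meas
    (fun k => (Q.measurable_lag_past k).mono (Q.past_le _) le_rfl) Q.X_law Q.ae_lag_nonneg ?_
    hh h0 hmean hc hbound
  exact fun j k hjk => Q.indepFun_X
    ((Q.measurable_excess_past (by omega)).prodMk (Q.measurable_lag_past k))

lemma integral_one_expMeasure : ∫ x, (if 0 ≤ x then (1 : ℝ) else 0) ∂expMeasure lam = 1 := by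
  rw [integral_step_expMeasure Q.lam_pos le_rfl]; simp

lemma integral_ramp_sub {b : ℝ} (hb : 0 ≤ b) :
    ∫ x, (max (x - b) 0 - Real.exp (-lam * b) / lam * if 0 ≤ x then (1 : ℝ) else 0)
      ∂expMeasure lam = 0 := by
  have := isProbabilityMeasure_expMeasure Q.lam_pos
  have h1 : Integrable (fun x : ℝ => max (x - b) 0) (expMeasure lam) :=
    (((memLp_two_id_expMeasure Q.lam_pos).integrable (by norm_num)).sub
      (integrable_const b)).pos_part
  have h2 : Integrable (fun x : ℝ => if 0 ≤ x then (1 : ℝ) else 0) (expMeasure lam) :=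
    Integrable.of_bound (Measurable.ite measurableSet_Ici measurable_const
      measurable_const).aestronglyMeasurable 1 (Eventually.of_forall fun x => by
        split_ifs <;> simp)
  rw [integral_sub h1 (h2.const_mul _), integral_const_mul, Q.integral_one_expMeasure,
    integral_ramp_expMeasure Q.lam_pos hb]
  ring

lemma integrable_passed (i : ℕ) : Integrable (passed n τ i) (expMeasure lam) := by
  have := isProbabilityMeasure_expMeasure Q.lam_pos
  exact Integrable.of_bound (measurable_passed n τ i).aestronglyMeasurable 1
    (Eventually.of_forall fun x => by
      rw [Real.norm_eq_abs, abs_of_nonneg (passed_nonneg n τ i x)]; exact passed_le_one n τ i x)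

lemma integral_passed {i : ℕ} (hi : 1 ≤ i) :
    ∫ x, passed n τ i x ∂expMeasure lam = passedMean lam n τ i := by
  by_cases h : i ≤ n
  · simp only [passed, passedMean, h, true_and, if_true]
    exact integral_step_expMeasure Q.lam_pos
      (nonneg_of_mem_Icc Q.tau_nonneg Q.tau_mono (Finset.mem_Icc.2 ⟨hi, h⟩))
  · simp [passed, passedMean, h]

/-- Per idle period, the time spent after instant `b` has mean `exp (-lam * b) / lam`. -/
lemma strong_law_ramp [IsProbabilityMeasure Pr] {b : ℝ} (hb : 0 ≤ b) : ∀ᵐ ω ∂Pr,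
    Tendsto (fun N : ℕ =>
      (∑ k ∈ Finset.range N, (max (excess n τ X S W k ω - b) 0
        - Real.exp (-lam * b) / lam * if 0 ≤ excess n τ X S W k ω then (1 : ℝ) else 0)) / N)
      atTop (𝓝 0) := by
  have hlam := Q.lam_pos
  have he : 0 ≤ Real.exp (-lam * b) / lam := by positivity
  refine Q.strong_law_comp_excess (h := fun y => max (y - b) 0
    - Real.exp (-lam * b) / lam * if 0 ≤ y then (1 : ℝ) else 0) ?_ ?_ (Q.integral_ramp_sub hb)
    he ?_
  · exact ((measurable_id.sub_const b).max measurable_const).sub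
      ((Measurable.ite measurableSet_Ici measurable_const measurable_const).const_mul _)
  · intro y hy
    rw [max_eq_right (by linarith), if_neg (by linarith)]
    simp
  · intro y hy
    have h1 : 0 ≤ max (y - b) 0 := le_max_right _ _
    have h2 : max (y - b) 0 ≤ y := max_le (by linarith) hy
    rw [if_pos hy, mul_one, abs_le]
    constructor <;> linarith

/-- State `i` is entered in a fraction `passedMean lam n τ i` of the idle periods. -/
lemma strong_law_passed [IsProbabilityMeasure Pr] {i : ℕ} (hi : 1 ≤ i) : ∀ᵐ ω ∂Pr,
    Tendsto (fun N : ℕ =>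
      (∑ k ∈ Finset.range N, (passed n τ i (excess n τ X S W k ω)
        - passedMean lam n τ i * if 0 ≤ excess n τ X S W k ω then (1 : ℝ) else 0)) / N)
      atTop (𝓝 0) := by
  have := isProbabilityMeasure_expMeasure Q.lam_pos
  have h2 : Integrable (fun x : ℝ => if 0 ≤ x then (1 : ℝ) else 0) (expMeasure lam) :=
    Integrable.of_bound (Measurable.ite measurableSet_Ici measurable_const
      measurable_const).aestronglyMeasurable 1 (Eventually.of_forall fun x => by
        split_ifs <;> simp)
  have hm0 : 0 ≤ passedMean lam n τ i := by unfold passedMean; split_ifs <;> positivity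
  refine Q.strong_law_comp_excess (h := fun y => passed n τ i y
    - passedMean lam n τ i * if 0 ≤ y then (1 : ℝ) else 0) ?_ ?_ ?_
    (c := 1 + passedMean lam n τ i) (by linarith) ?_
  · exact (measurable_passed n τ i).sub
      ((Measurable.ite measurableSet_Ici measurable_const measurable_const).const_mul _)
  · intro y hy
    rw [passed_of_neg Q.tau_nonneg Q.tau_mono hi hy, if_neg (by linarith)]
    simp
  · rw [integral_sub (Q.integrable_passed i) (h2.const_mul _), integral_const_mul,
      Q.integral_one_expMeasure, Q.integral_passed hi]
    ring
  · intro y hy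
    have h3 := passed_nonneg n τ i y
    have h4 := passed_le_one n τ i y
    rw [if_pos hy, mul_one, abs_le]
    constructor <;> linarith

/-- The latencies incurred on waking up from state `i` average to `w i`. -/
lemma strong_law_latency [IsProbabilityMeasure Pr] {i : ℕ} (hi : i ∈ Finset.Icc 1 n) : ∀ᵐ ω ∂Pr,
    Tendsto (fun N : ℕ =>
      (∑ k ∈ Finset.range N, (W i k ω - w i) * (passed n τ i (excess n τ X S W k ω)
        - passed n τ (i + 1) (excess n τ X S W k ω))) / N) atTop (𝓝 0) := by
  have h1 := (Finset.mem_Icc.1 hi).1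
  rw [← Q.W_mean i hi]
  refine strong_law_thinned (Q.W_meas i hi)
    (fun k => (Q.measurable_passed_diff (Nat.lt_succ_self (3 * k))).mono (Q.past_le _) le_rfl)
    (fun k ω => passed_sub_passed_nonneg Q.tau_mono h1 _)
    (fun k ω => passed_sub_passed_le_one Q.tau_mono h1 _) (Q.W_int i hi) (Q.W_ident i hi) ?_
  exact fun j k hjk => Q.indepFun_W hi
    (((measurable_latency_past hi (by omega)).prodMk
      (Q.measurable_passed_diff (by omega))).prodMk (Q.measurable_passed_diff (by omega)))

lemma w_nonneg {i : ℕ} (hi : i ∈ Finset.Icc 1 n) : 0 ≤ w i := by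
  rw [← Q.W_mean i hi]; exact integral_nonneg_of_ae (Q.W_nonneg i hi 0)

lemma stateSum_nonneg (hn : 1 ≤ n) : 0 ≤ stateSum lam n τ w := by
  rw [stateSum_eq lam hn]
  refine Finset.sum_nonneg fun i hi => mul_nonneg (Q.w_nonneg hi) ?_
  have h1 := (Finset.mem_Icc.1 hi).1
  rw [← Q.integral_passed h1, ← Q.integral_passed (by omega : 1 ≤ i + 1),
    ← integral_sub (Q.integrable_passed _) (Q.integrable_passed _)]
  exact integral_nonneg fun x => passed_sub_passed_nonneg Q.tau_mono h1 x

/-- The laws of large numbers for the number of completed cycles and for the energy. -/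
lemma ae_limits [IsProbabilityMeasure Pr] (hn : 1 ≤ n) (P : ℕ → ℝ) : ∀ᵐ ω ∂Pr,
    Tendsto (fun N : ℕ =>
      cleared n τ (fun j => X j ω) (fun j => S j ω) (fun i j => W i j ω) N / N) atTop
      (𝓝 (1 / lam)) ∧
    Tendsto (fun N : ℕ => (∑ k ∈ Finset.range N,
      if 0 ≤ excess n τ X S W k ω then (1 : ℝ) else 0) / N) atTop
      (𝓝 ((1 / lam - 1 / r) / (1 / lam + stateSum lam n τ w))) ∧
    Tendsto (fun N : ℕ => (∑ k ∈ Finset.range N, idleEnergy n P τ (excess n τ X S W k ω)) / N) atTop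
      (𝓝 ((stateSum lam n τ P - P 0 * Real.exp (-lam * τ 1)) / lam *
        ((1 / lam - 1 / r) / (1 / lam + stateSum lam n τ w)))) := by
  have hlam := Q.lam_pos
  have hWae : ∀ᵐ ω ∂Pr, ∀ i ∈ Finset.Icc 1 n,
      Tendsto (fun N : ℕ => (∑ k ∈ Finset.range N, W i k ω) / N) atTop (𝓝 (w i)) := by
    rw [Filter.eventually_all_finset]; exact fun i hi => Q.strong_law_W hi
  have hLae : ∀ᵐ ω ∂Pr, ∀ i ∈ Finset.Icc 1 n, Tendsto (fun N : ℕ =>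
      (∑ k ∈ Finset.range N, (W i k ω - w i) * (passed n τ i (excess n τ X S W k ω)
        - passed n τ (i + 1) (excess n τ X S W k ω))) / N) atTop (𝓝 0) := by
    rw [Filter.eventually_all_finset]; exact fun i hi => Q.strong_law_latency hi
  have hRae : ∀ᵐ ω ∂Pr, ∀ i ∈ Finset.Icc 1 n, Tendsto (fun N : ℕ =>
      (∑ k ∈ Finset.range N, (max (excess n τ X S W k ω - τ i) 0
        - Real.exp (-lam * τ i) / lam * if 0 ≤ excess n τ X S W k ω then (1 : ℝ) else 0)) / N)
      atTop (𝓝 0) := by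
    rw [Filter.eventually_all_finset]
    exact fun i hi => Q.strong_law_ramp (nonneg_of_mem_Icc Q.tau_nonneg Q.tau_mono hi)
  have hPae : ∀ᵐ ω ∂Pr, ∀ i, Tendsto (fun N : ℕ =>
      (∑ k ∈ Finset.range N, (passed n τ (i + 1) (excess n τ X S W k ω)
        - passedMean lam n τ (i + 1) * if 0 ≤ excess n τ X S W k ω then (1 : ℝ) else 0)) / N)
      atTop (𝓝 0) := ae_all_iff.2 fun i => Q.strong_law_passed (by omega)
  filter_upwards [Q.ae_nonneg, Q.strong_law_X, Q.strong_law_S, hWae, hLae, hRae, hPae,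
    Q.strong_law_ramp le_rfl] with ω h0 hXl hSl hWl hLl hRl hPl hIl
  have hI : Tendsto (fun N : ℕ => (∑ k ∈ Finset.range N, (max (excess n τ X S W k ω) 0
      - 1 / lam * if 0 ≤ excess n τ X S W k ω then (1 : ℝ) else 0)) / N) atTop (𝓝 0) := by
    simpa using hIl
  have hV : Tendsto (fun N : ℕ => (∑ k ∈ Finset.range N,
      (wakeUp n τ (fun i => W i k ω) (excess n τ X S W k ω)
        - stateSum lam n τ w * if 0 ≤ excess n τ X S W k ω then (1 : ℝ) else 0)) / N)
      atTop (𝓝 0) := by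
    have h1 := tendsto_finsetSum (Finset.Icc 1 n) fun i hi =>
      (hLl i hi).add (((hPl (i - 1)).sub (hPl i)).const_mul (w i))
    simp only [sub_zero, mul_zero, add_zero, Finset.sum_const_zero] at h1
    refine h1.congr fun N => ?_
    have e : ∀ k, wakeUp n τ (fun i => W i k ω) (excess n τ X S W k ω)
        - stateSum lam n τ w * (if 0 ≤ excess n τ X S W k ω then (1 : ℝ) else 0) =
        ∑ i ∈ Finset.Icc 1 n, ((W i k ω - w i) * (passed n τ i (excess n τ X S W k ω)
          - passed n τ (i + 1) (excess n τ X S W k ω)) + w i * ((passed n τ i (excess n τ X S W k ω)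
          - passedMean lam n τ i * (if 0 ≤ excess n τ X S W k ω then (1 : ℝ) else 0)) -
          (passed n τ (i + 1) (excess n τ X S W k ω)
          - passedMean lam n τ (i + 1) * (if 0 ≤ excess n τ X S W k ω then (1 : ℝ) else 0)))) := by
      intro k
      rw [wakeUp_eq_sum Q.tau_mono, stateSum_eq lam hn, Finset.sum_mul, ← Finset.sum_sub_distrib]
      exact Finset.sum_congr rfl fun i _ => by ring
    simp_rw [e]
    rw [Finset.sum_comm, Finset.sum_div]
    refine Finset.sum_congr rfl fun i hi => ?_
    rw [Nat.sub_add_cancel (Finset.mem_Icc.1 hi).1, ← sub_div, ← mul_div_assoc, ← add_div,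
      Finset.sum_add_distrib, ← Finset.mul_sum]
    simp only [Finset.sum_sub_distrib]
  have hsx : 1 / r ≤ 1 / lam := one_div_le_one_div_of_le hlam Q.stable.le
  have hxV : 0 < 1 / lam + stateSum lam n τ w := by
    have := Q.stateSum_nonneg hn
    positivity
  obtain ⟨hC, hM⟩ := tendsto_empty_fraction Q.tau_nonneg Q.tau_mono h0.1 h0.2.1 h0.2.2 hsx hxV
    hXl hSl hWl hI hV
  refine ⟨hC, hM, ?_⟩
  have h1 := (tendsto_finsetSum (Finset.Icc 1 n) fun i hi =>
    (hRl i hi).const_mul (P i - P (i - 1))).add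
      (hM.const_mul ((stateSum lam n τ P - P 0 * Real.exp (-lam * τ 1)) / lam))
  simp only [mul_zero, Finset.sum_const_zero, zero_add] at h1
  refine h1.congr fun N => ?_
  have e : ∀ k, idleEnergy n P τ (excess n τ X S W k ω) =
      ∑ i ∈ Finset.Icc 1 n, (P i - P (i - 1)) * (max (excess n τ X S W k ω - τ i) 0
        - Real.exp (-lam * τ i) / lam * (if 0 ≤ excess n τ X S W k ω then (1 : ℝ) else 0)) +
      (stateSum lam n τ P - P 0 * Real.exp (-lam * τ 1)) / lam *
        (if 0 ≤ excess n τ X S W k ω then (1 : ℝ) else 0) := by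
    intro k
    rw [← sum_increments_eq_stateSum lam hn, idleEnergy, Finset.sum_div, Finset.sum_mul,
      ← Finset.sum_add_distrib]
    exact Finset.sum_congr rfl fun i _ => by ring
  simp_rw [e]
  rw [Finset.sum_add_distrib, ← Finset.mul_sum, add_div, Finset.sum_comm, mul_div_assoc]
  congr 1
  rw [Finset.sum_div]
  refine Finset.sum_congr rfl fun i _ => ?_
  rw [← Finset.mul_sum, mul_div_assoc]

end IsSleepQueue

/-! ### The first cycle -/

/-- For the sequence `y` of excesses, `alive y k` is `1` if none of the jobs `1, …, k` finds the
system empty, that is, if more than `k` jobs are served in the first cycle, and `0` otherwise. -/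
noncomputable def alive (y : ℕ → ℝ) (k : ℕ) : ℝ :=
  ∏ j ∈ Finset.range k, if y (j + 1) < 0 then 1 else 0

lemma alive_zero (y : ℕ → ℝ) : alive y 0 = 1 := by simp [alive]

lemma alive_succ (y : ℕ → ℝ) (k : ℕ) :
    alive y (k + 1) = alive y k * if y (k + 1) < 0 then 1 else 0 := by
  rw [alive, Finset.prod_range_succ, ← alive]

lemma alive_eq_ite (y : ℕ → ℝ) (k : ℕ) [Decidable (∀ j < k, y (j + 1) < 0)] :
    alive y k = if ∀ j < k, y (j + 1) < 0 then 1 else 0 := by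
  by_cases h : ∀ j < k, y (j + 1) < 0
  · rw [if_pos h, alive]
    exact Finset.prod_eq_one fun j hj => if_pos (h j (Finset.mem_range.1 hj))
  · rw [if_neg h, alive]
    push Not at h
    obtain ⟨j, hj, hj'⟩ := h
    exact Finset.prod_eq_zero (Finset.mem_range.2 hj) (if_neg (not_lt.2 hj'))

lemma alive_nonneg (y : ℕ → ℝ) (k : ℕ) : 0 ≤ alive y k := by
  classical
  rw [alive_eq_ite]; split_ifs <;> norm_num

lemma alive_le_one (y : ℕ → ℝ) (k : ℕ) : alive y k ≤ 1 := by
  classical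
  rw [alive_eq_ite]; split_ifs <;> norm_num

lemma alive_mul_indicator (y : ℕ → ℝ) (k : ℕ) :
    (alive y k * if 0 ≤ y (k + 1) then 1 else 0) = alive y k - alive y (k + 1) := by
  rw [alive_succ]
  rcases lt_or_ge (y (k + 1)) 0 with h | h
  · simp [h, not_le.2 h]
  · simp [h, not_lt.2 h]

lemma alive_eq_zero {y : ℕ → ℝ} {j k : ℕ} (hj : 1 ≤ j) (hjk : j ≤ k) (h : 0 ≤ y j) :
    alive y k = 0 := by
  classical
  rw [alive_eq_ite, if_neg]
  intro h'
  have := h' (j - 1) (by omega)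
  rw [Nat.sub_add_cancel hj] at this
  linarith

section Path

variable {n : ℕ} {τ : ℕ → ℝ} (hτ0 : 0 ≤ τ 1) (hτ : StrictMonoOn τ (Set.Icc 1 n))
  {X S : ℕ → ℝ} {W : ℕ → ℕ → ℝ} {y : ℕ → ℝ} (hy : ∀ k, y k = X k - lag n τ X S W k)

include hτ0 hτ hy

lemma excess_succ (k : ℕ) :
    y (k + 1) = X (k + 1) - S k - wakeUp n τ (fun i => W i k) (y k) + y k - max (y k) 0 := by
  rw [hy, hy, lag, cleared_succ hτ0 hτ, Finset.sum_range_succ]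
  simp only [lag]
  ring

lemma excess_succ_of_neg {k : ℕ} (h : y k < 0) : y (k + 1) = X (k + 1) - S k + y k := by
  rw [excess_succ hτ0 hτ hy, max_eq_right h.le, wakeUp, if_pos (idleState_of_neg hτ0 hτ h)]
  ring

/-- Balance of arrivals and services over the part of the first cycle that concerns the first
`N + 1` jobs. -/
lemma cycle_balance (h0 : 0 ≤ y 0) (N : ℕ) :
    ∑ k ∈ Finset.range (N + 1), alive y k * (X (k + 1) - S k) =
      wakeUp n τ (fun i => W i 0) (y 0)
        + ∑ k ∈ Finset.range (N + 1), alive y k * max (y (k + 1)) 0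
        - alive y (N + 1) * (-y (N + 1)) := by
  have hpm : ∀ a c : ℝ, a * max c 0 - (a * if c < 0 then 1 else 0) * -c = a * c := by
    intro a c
    rcases lt_or_ge c 0 with h | h
    · rw [max_eq_right h.le, if_pos h]; ring
    · rw [max_eq_left h, if_neg (not_lt.2 h)]; ring
  induction N with
  | zero =>
    have h1 := excess_succ hτ0 hτ hy 0
    rw [max_eq_left h0] at h1
    have h2 := hpm (alive y 0) (y 1)
    simp only [zero_add, Finset.sum_range_one] at h1 h2 ⊢
    rw [show (1 : ℕ) = 0 + 1 from rfl, alive_succ, zero_add]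
    rw [alive_zero] at *
    linarith
  | succ N ih =>
    rw [Finset.sum_range_succ, ih, Finset.sum_range_succ _ (N + 1), alive_succ y (N + 1)]
    have h2 := hpm (alive y (N + 1)) (y (N + 1 + 1))
    have h3 : alive y (N + 1) * (X (N + 1 + 1) - S (N + 1)) =
        alive y (N + 1) * (y (N + 1 + 1) - y (N + 1)) := by
      rcases lt_or_ge (y (N + 1)) 0 with h | h
      · rw [excess_succ_of_neg hτ0 hτ hy h]; ring
      · rw [alive_eq_zero (by omega) le_rfl h]; ring
    linarith

lemma alive_mul_neg_excess_le (hX : ∀ k, 0 ≤ X k) (h0 : 0 ≤ y 0) (N : ℕ)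
    (hW : 0 ≤ wakeUp n τ (fun i => W i 0) (y 0)) (hS : ∀ k, 0 ≤ S k) :
    alive y (N + 1) * (-y (N + 1)) ≤ wakeUp n τ (fun i => W i 0) (y 0)
      + ∑ k ∈ Finset.range (N + 1), alive y k * S k := by
  classical
  have hb := cycle_balance hτ0 hτ hy h0 N
  by_cases h : ∀ j < N + 1, y (j + 1) < 0
  · have hz : ∑ k ∈ Finset.range (N + 1), alive y k * max (y (k + 1)) 0 = 0 :=
      Finset.sum_eq_zero fun k hk => by
        rw [max_eq_right (h k (Finset.mem_range.1 hk)).le, mul_zero]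
    have hx : 0 ≤ ∑ k ∈ Finset.range (N + 1), alive y k * X (k + 1) :=
      Finset.sum_nonneg fun k _ => mul_nonneg (alive_nonneg y k) (hX _)
    simp_rw [mul_sub] at hb
    rw [Finset.sum_sub_distrib] at hb
    linarith
  · rw [alive_eq_ite, if_neg h, zero_mul]
    exact add_nonneg hW (Finset.sum_nonneg fun k _ => mul_nonneg (alive_nonneg y k) (hS k))

/-- The first cycle consists of an idle period, a wake-up and the services of its jobs. -/
lemma cycleLength_eq (h0 : 0 ≤ y 0) (hne : (findsEmpty n τ X S W).Nonempty) :
    cycleLength n τ X S W =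
      y 0 + wakeUp n τ (fun i => W i 0) (y 0) + ∑' k, alive y k * S k := by
  set K := sInf (findsEmpty n τ X S W) with hK
  have hmem : ∀ k, k ∈ findsEmpty n τ X S W ↔ 1 ≤ k ∧ 0 ≤ y k := fun k => by
    rw [findsEmpty, Set.mem_ofPred_eq, hy, ← arrival_sub_cleared, sub_nonneg]
  have hKmem := (hmem K).1 (Nat.sInf_mem hne)
  have hlt : ∀ j, 1 ≤ j → j < K → y j < 0 := fun j hj hjK => by
    by_contra h
    exact absurd (Nat.sInf_le ((hmem j).2 ⟨hj, not_lt.1 h⟩)) (not_le.2 hjK)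
  have hts : ∑' k, alive y k * S k = ∑ k ∈ Finset.range K, S k := by
    rw [tsum_eq_sum (s := Finset.range K)]
    · refine Finset.sum_congr rfl fun k hk => ?_
      classical
      rw [alive_eq_ite, if_pos, one_mul]
      intro j hj
      exact hlt _ (by omega) (by have := Finset.mem_range.1 hk; omega)
    · intro k hk
      rw [alive_eq_zero hKmem.1 (not_lt.1 fun h => hk (Finset.mem_range.2 h)) hKmem.2, zero_mul]
  have hcl : ∀ k, 1 ≤ k → k ≤ K → cleared n τ X S W k =
      y 0 + wakeUp n τ (fun i => W i 0) (y 0) + ∑ j ∈ Finset.range k, S j := by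
    intro k hk
    induction k, hk using Nat.le_induction with
    | base =>
      intro _
      rw [cleared_succ hτ0 hτ, ← hy, max_eq_left h0]
      simp [cleared]
    | succ k hk ih =>
      intro hkK
      have hneg := hlt k hk (by omega)
      rw [cleared_succ hτ0 hτ, ← hy, max_eq_right hneg.le, wakeUp,
        if_pos (idleState_of_neg hτ0 hτ hneg), ih (by omega), Finset.sum_range_succ]
      ring
  rw [cycleLength, ← hK, hcl K hKmem.1 le_rfl, hts]

end Path

lemma excess_zero {Ω : Type*} {n : ℕ} {τ : ℕ → ℝ} {X S : ℕ → Ω → ℝ} {W : ℕ → ℕ → Ω → ℝ} (ω : Ω) :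
    excess n τ X S W 0 ω = X 0 ω := by
  rw [excess, lag_zero, sub_zero]

namespace IsSleepQueue

variable {Ω : Type*} [MeasurableSpace Ω] {Pr : Measure Ω} {lam r : ℝ}
  {n : ℕ} {τ w : ℕ → ℝ} {X S : ℕ → Ω → ℝ} {W : ℕ → ℕ → Ω → ℝ}
  (Q : IsSleepQueue Pr lam r n τ w X S W)

include Q

lemma ae_findsEmpty_nonempty [IsProbabilityMeasure Pr] (hn : 1 ≤ n) : ∀ᵐ ω ∂Pr,
    (findsEmpty n τ (fun k => X k ω) (fun k => S k ω) (fun i k => W i k ω)).Nonempty := by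
  filter_upwards [Q.ae_limits hn 0] with ω hω
  by_contra hne
  have hneg : ∀ k, 1 ≤ k → ¬ 0 ≤ excess n τ X S W k ω := by
    intro k hk h
    refine hne ⟨k, hk, ?_⟩
    rw [← sub_nonneg, arrival_sub_cleared]
    exact h
  have hlim : Tendsto (fun N : ℕ => (∑ k ∈ Finset.range N,
      if 0 ≤ excess n τ X S W k ω then (1 : ℝ) else 0) / N) atTop (𝓝 0) := by
    refine squeeze_zero (fun N => ?_) (fun N => ?_) tendsto_one_div_atTop_nhds_zero_nat
    · exact div_nonneg (Finset.sum_nonneg fun k _ => by split_ifs <;> norm_num) (Nat.cast_nonneg _)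
    · refine div_le_div_of_nonneg_right ?_ (Nat.cast_nonneg _)
      calc _ ≤ ∑ k ∈ Finset.range N, if k = 0 then (1 : ℝ) else 0 := by
            refine Finset.sum_le_sum fun k _ => ?_
            rcases Nat.eq_zero_or_pos k with rfl | hk
            · rw [if_pos rfl]; split_ifs <;> norm_num
            · rw [if_neg (hneg k hk), if_neg hk.ne']
        _ ≤ 1 := by
            rw [Finset.sum_ite_eq']
            split_ifs <;> norm_num
  have hV := Q.stateSum_nonneg hn
  have hlam := Q.lam_pos
  have h1 : 1 / r < 1 / lam := one_div_lt_one_div_of_lt hlam Q.stable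
  have hp : 0 < (1 / lam - 1 / r) / (1 / lam + stateSum lam n τ w) :=
    div_pos (by linarith) (by positivity)
  exact hp.ne (tendsto_nhds_unique hlim hω.2.1)

section Alive

lemma measurable_alive_past {k t : ℕ} (h : 3 * k < t) :
    Measurable[past n X S W t] fun ω => alive (fun j => excess n τ X S W j ω) k := by
  unfold alive
  refine Finset.measurable_prod _ fun j hj => ?_
  have := Finset.mem_range.1 hj
  exact Measurable.ite (measurableSet_Iio.preimage (Q.measurable_excess_past (by omega)))
    measurable_const measurable_const

lemma measurable_alive (k : ℕ) : Measurable fun ω => alive (fun j => excess n τ X S W j ω) k :=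
  (Q.measurable_alive_past (Nat.lt_succ_self _)).mono (Q.past_le _) le_rfl

lemma integrable_alive [IsProbabilityMeasure Pr] (k : ℕ) :
    Integrable (fun ω => alive (fun j => excess n τ X S W j ω) k) Pr :=
  Integrable.of_bound (Q.measurable_alive k).aestronglyMeasurable 1 <|
    Eventually.of_forall fun ω => by
    rw [Real.norm_eq_abs, abs_of_nonneg (alive_nonneg _ _)]; exact alive_le_one _ _

lemma integrable_alive_mul {V : Ω → ℝ} (hV : Integrable V Pr) (k : ℕ) :
    Integrable (fun ω => alive (fun j => excess n τ X S W j ω) k * V ω) Pr :=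
  hV.bdd_mul (c := 1) (Q.measurable_alive k).aestronglyMeasurable (Eventually.of_forall fun ω => by
    rw [Real.norm_eq_abs, abs_of_nonneg (alive_nonneg _ _)]; exact alive_le_one _ _)

lemma integral_alive_mul_S (k : ℕ) :
    ∫ ω, alive (fun j => excess n τ X S W j ω) k * S k ω ∂Pr =
      (∫ ω, alive (fun j => excess n τ X S W j ω) k ∂Pr) * (1 / r) := by
  rw [← Q.integral_S k]
  exact (Q.indepFun_S (Q.measurable_alive_past (by omega))).integral_fun_mul_eq_mul_integral
    (Q.measurable_alive k).aestronglyMeasurable (Q.S_meas k).aestronglyMeasurable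

lemma integral_alive_mul_X (k : ℕ) :
    ∫ ω, alive (fun j => excess n τ X S W j ω) k * X (k + 1) ω ∂Pr =
      (∫ ω, alive (fun j => excess n τ X S W j ω) k ∂Pr) * (1 / lam) := by
  rw [← Q.integral_X (k + 1)]
  exact (Q.indepFun_X (Q.measurable_alive_past (by omega))).integral_fun_mul_eq_mul_integral
    (Q.measurable_alive k).aestronglyMeasurable (Q.X_meas (k + 1)).aestronglyMeasurable

lemma integrable_excess_pos (k : ℕ) : Integrable (fun ω => max (excess n τ X S W k ω) 0) Pr := by
  refine (Q.integrable_X k).abs.mono' ((Q.measurable_excess k).max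
    measurable_const).aestronglyMeasurable ?_
  filter_upwards [Q.ae_lag_nonneg k] with ω hω
  rw [Real.norm_eq_abs, abs_of_nonneg (le_max_right _ _)]
  refine max_le ?_ (abs_nonneg _)
  have := le_abs_self (X k ω)
  simp only [excess]
  linarith

/-- The idle period that ends the first cycle has mean `1 / lam`. -/
lemma integral_alive_mul_excess_pos [IsProbabilityMeasure Pr] (k : ℕ) :
    ∫ ω, alive (fun j => excess n τ X S W j ω) k * max (excess n τ X S W (k + 1) ω) 0 ∂Pr =
      1 / lam * (∫ ω, alive (fun j => excess n τ X S W j ω) k ∂Pr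
        - ∫ ω, alive (fun j => excess n τ X S W j ω) (k + 1) ∂Pr) := by
  have e : ∀ ω, alive (fun j => excess n τ X S W j ω) k * (max (excess n τ X S W (k + 1) ω - 0) 0
      - Real.exp (-lam * 0) / lam * if 0 ≤ excess n τ X S W (k + 1) ω then (1 : ℝ) else 0) =
      alive (fun j => excess n τ X S W j ω) k * max (excess n τ X S W (k + 1) ω) 0
        - 1 / lam * (alive (fun j => excess n τ X S W j ω) k
          - alive (fun j => excess n τ X S W j ω) (k + 1)) := by
    intro ω
    rw [← alive_mul_indicator, sub_zero, mul_zero, Real.exp_zero]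
    ring
  have i1 := Q.integrable_alive_mul (Q.integrable_excess_pos (k + 1)) k
  have i2 : Integrable (fun ω => 1 / lam * (alive (fun j => excess n τ X S W j ω) k
      - alive (fun j => excess n τ X S W j ω) (k + 1))) Pr :=
    ((Q.integrable_alive k).sub (Q.integrable_alive (k + 1))).const_mul (1 / lam)
  have key := integral_mul_comp_excess_eq_zero Q.lam_pos
    (Y := fun ω => alive (fun j => excess n τ X S W j ω) k)
    (Q.indepFun_X (k := k + 1) ((Q.measurable_alive_past (by omega)).prodMk
      (Q.measurable_lag_past (k + 1))))
    (Q.measurable_alive k) ((Q.measurable_lag_past (k + 1)).mono (Q.past_le _) le_rfl)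
    (Q.X_meas (k + 1)) (Q.X_law (k + 1)) (Q.ae_lag_nonneg (k + 1))
    (h := fun y => max (y - 0) 0 - Real.exp (-lam * 0) / lam * if 0 ≤ y then (1 : ℝ) else 0)
    (((measurable_id.sub_const 0).max measurable_const).sub
      ((Measurable.ite measurableSet_Ici measurable_const measurable_const).const_mul _))
    (fun y hy => by rw [max_eq_right (by linarith), if_neg (by linarith)]; simp)
    (Q.integral_ramp_sub le_rfl) ((i1.sub i2).congr (Eventually.of_forall fun ω => (e ω).symm))
  have key2 : ∫ ω, (alive (fun j => excess n τ X S W j ω) k * max (excess n τ X S W (k + 1) ω) 0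
        - 1 / lam * (alive (fun j => excess n τ X S W j ω) k
          - alive (fun j => excess n τ X S W j ω) (k + 1))) ∂Pr = 0 :=
    (integral_congr_ae (Eventually.of_forall fun ω => (e ω).symm)).trans key
  rw [integral_sub i1 i2, integral_const_mul,
    integral_sub (Q.integrable_alive k) (Q.integrable_alive (k + 1))] at key2
  linarith

end Alive

lemma integrable_latency_mul {i : ℕ} (hi : i ∈ Finset.Icc 1 n) :
    Integrable (fun ω => W i 0 ω * (passed n τ i (excess n τ X S W 0 ω)
      - passed n τ (i + 1) (excess n τ X S W 0 ω))) Pr := by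
  have h1 := (Finset.mem_Icc.1 hi).1
  refine (Q.W_int i hi).mul_bdd (c := 1) ?_ (Eventually.of_forall fun ω => ?_)
  · exact ((Q.measurable_passed_diff (Nat.lt_succ_self _)).mono
      (Q.past_le _) le_rfl).aestronglyMeasurable
  · rw [Real.norm_eq_abs, abs_of_nonneg (passed_sub_passed_nonneg Q.tau_mono h1 _)]
    exact passed_sub_passed_le_one Q.tau_mono h1 _

lemma integrable_wakeUp :
    Integrable (fun ω => wakeUp n τ (fun i => W i 0 ω) (excess n τ X S W 0 ω)) Pr := by
  simp_rw [wakeUp_eq_sum Q.tau_mono]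
  exact integrable_finsetSum _ fun i hi => Q.integrable_latency_mul hi

lemma integral_passed_excess {i : ℕ} (hi : 1 ≤ i) :
    ∫ ω, passed n τ i (excess n τ X S W 0 ω) ∂Pr = passedMean lam n τ i := by
  simp_rw [excess_zero]
  rw [← Q.integral_passed hi, ← Q.X_law 0, integral_map (Q.X_meas 0).aemeasurable
    (measurable_passed n τ i).aestronglyMeasurable]

lemma integral_wakeUp [IsProbabilityMeasure Pr] (hn : 1 ≤ n) :
    ∫ ω, wakeUp n τ (fun i => W i 0 ω) (excess n τ X S W 0 ω) ∂Pr = stateSum lam n τ w := by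
  simp_rw [wakeUp_eq_sum Q.tau_mono]
  rw [integral_finsetSum _ fun i hi => Q.integrable_latency_mul hi, stateSum_eq lam hn]
  refine Finset.sum_congr rfl fun i hi => ?_
  have h1 := (Finset.mem_Icc.1 hi).1
  have hm := Q.measurable_passed_diff (k := 0) (i := i) (Nat.lt_succ_self _)
  have hint : ∀ j, Integrable (fun ω => passed n τ j (excess n τ X S W 0 ω)) Pr := fun j =>
    Integrable.of_bound ((measurable_passed n τ j).comp (Q.measurable_excess 0)
      ).aestronglyMeasurable 1 (Eventually.of_forall fun ω => by
        rw [Real.norm_eq_abs, abs_of_nonneg (passed_nonneg _ _ _ _)]; exact passed_le_one _ _ _ _)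
  rw [(Q.indepFun_W hi hm).symm.integral_fun_mul_eq_mul_integral
    (Q.W_meas i hi 0).aestronglyMeasurable
    (hm.mono (Q.past_le _) le_rfl).aestronglyMeasurable, Q.W_mean i hi,
    integral_sub (hint i) (hint (i + 1)), Q.integral_passed_excess h1,
    Q.integral_passed_excess (by omega)]

/-- The mean length of the first cycle. The number `K` of its jobs has tail probabilities
`E (alive k)`, so `E K` is their sum. By Wald's identity the balance of arrivals and services over
the cycle reads `(1 / lam - 1 / r) * E K = stateSum + 1 / lam`. -/
lemma integral_cycleLength [IsProbabilityMeasure Pr] (hn : 1 ≤ n) :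
    Integrable (fun ω =>
      cycleLength n τ (fun k => X k ω) (fun k => S k ω) (fun i k => W i k ω)) Pr ∧
    ∫ ω, cycleLength n τ (fun k => X k ω) (fun k => S k ω) (fun i k => W i k ω) ∂Pr =
      1 / lam * ((1 / lam + stateSum lam n τ w) / (1 / lam - 1 / r)) := by
  have hlam := Q.lam_pos
  have hr := Q.r_pos
  have hV := Q.stateSum_nonneg hn
  have hdrift : 0 < 1 / lam - 1 / r := sub_pos.2 (one_div_lt_one_div_of_lt hlam Q.stable)
  set V := stateSum lam n τ w
  let y : Ω → ℕ → ℝ := fun ω j => excess n τ X S W j ω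
  let wake : Ω → ℝ := fun ω => wakeUp n τ (fun i => W i 0 ω) (y ω 0)
  let A : ℕ → ℝ := fun k => ∫ ω, alive (y ω) k ∂Pr
  let R : ℕ → ℝ := fun N => ∫ ω, alive (y ω) (N + 1) * (-y ω (N + 1)) ∂Pr
  have hA0 : A 0 = 1 := by simp [A, alive_zero]
  have hAnn : ∀ k, 0 ≤ A k := fun k => integral_nonneg fun ω => alive_nonneg _ _
  have hRnn : ∀ N, 0 ≤ R N := fun N => integral_nonneg fun ω => by
    rcases lt_or_ge (y ω (N + 1)) 0 with h | h
    · exact mul_nonneg (alive_nonneg _ _) (by linarith)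
    · simp only [alive_eq_zero (y := y ω) (by omega) le_rfl h, zero_mul]; exact le_rfl
  have hS_i : ∀ k, Integrable (fun ω => alive (y ω) k * S k ω) Pr := fun k =>
    Q.integrable_alive_mul (Q.integrable_S k) k
  have hX_i : ∀ k, Integrable (fun ω => alive (y ω) k * X (k + 1) ω) Pr := fun k =>
    Q.integrable_alive_mul (Q.integrable_X (k + 1)) k
  have hE_i : ∀ k, Integrable (fun ω => alive (y ω) k * max (y ω (k + 1)) 0) Pr := fun k =>
    Q.integrable_alive_mul (Q.integrable_excess_pos (k + 1)) k
  -- the balance in the mean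
  have hbal : ∀ N, (1 / lam - 1 / r) * ∑ k ∈ Finset.range (N + 1), A k =
      V + 1 / lam * (1 - A (N + 1)) - R N := by
    intro N
    have hpath : ∀ᵐ ω ∂Pr, alive (y ω) (N + 1) * (-y ω (N + 1)) =
        wake ω + ∑ k ∈ Finset.range (N + 1), (alive (y ω) k * max (y ω (k + 1)) 0
          - (alive (y ω) k * X (k + 1) ω - alive (y ω) k * S k ω)) := by
      filter_upwards [Q.ae_nonneg] with ω hω
      have h0 : 0 ≤ y ω 0 := by simp only [y, excess_zero]; exact hω.1 0
      have := cycle_balance Q.tau_nonneg Q.tau_mono (y := y ω) (fun k => rfl) h0 N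
      rw [Finset.sum_sub_distrib]
      simp_rw [← mul_sub]
      simp only [wake]
      linarith
    have hT_i : ∀ k, Integrable (fun ω => alive (y ω) k * max (y ω (k + 1)) 0
        - (alive (y ω) k * X (k + 1) ω - alive (y ω) k * S k ω)) Pr := fun k =>
      (hE_i k).sub ((hX_i k).sub (hS_i k))
    have hRe : R N = V + ∑ k ∈ Finset.range (N + 1), (1 / lam * (A k - A (k + 1))
        - (A k * (1 / lam) - A k * (1 / r))) := by
      simp only [R]
      rw [integral_congr_ae hpath, integral_add Q.integrable_wakeUp
        (integrable_finsetSum _ fun k _ => hT_i k), integral_finsetSum _ fun k _ => hT_i k]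
      congr 1
      · exact Q.integral_wakeUp hn
      · refine Finset.sum_congr rfl fun k _ => ?_
        rw [integral_sub (hE_i k) (by exact (hX_i k).sub (hS_i k)), integral_sub (hX_i k) (hS_i k)]
        simp only [A, y]
        rw [Q.integral_alive_mul_excess_pos, Q.integral_alive_mul_X, Q.integral_alive_mul_S]
    have htel := Finset.sum_range_sub' A (N + 1)
    rw [hRe, Finset.sum_sub_distrib, ← Finset.mul_sum, htel, hA0, Finset.sum_sub_distrib,
      ← Finset.sum_mul, ← Finset.sum_mul]
    ring
  have hsum : Summable A := by
    refine summable_of_sum_range_le (c := (V + 1 / lam) / (1 / lam - 1 / r)) hAnn fun N => ?_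
    have h1 := hbal N
    have h2 := Finset.sum_range_succ A N
    have h3 : 0 ≤ 1 / lam * A (N + 1) := mul_nonneg (by positivity) (hAnn _)
    rw [le_div_iff₀ hdrift]
    have h4 : (1 / lam - 1 / r) * ∑ k ∈ Finset.range N, A k ≤
        (1 / lam - 1 / r) * ∑ k ∈ Finset.range (N + 1), A k :=
      mul_le_mul_of_nonneg_left (by linarith [hAnn N]) hdrift.le
    have := hRnn N
    linarith
  -- total service time of the cycle
  have hSn : ∀ k, ∫ ω, ‖alive (y ω) k * S k ω‖ ∂Pr = A k * (1 / r) := by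
    intro k
    rw [← Q.integral_alive_mul_S k]
    refine integral_congr_ae ?_
    filter_upwards [Q.ae_nonneg] with ω hω
    exact Real.norm_of_nonneg (mul_nonneg (alive_nonneg _ _) (hω.2.1 k))
  have hsumS : HasSum (fun k => A k * (1 / r)) (∫ ω, ∑' k, alive (y ω) k * S k ω ∂Pr) := by
    have := hasSum_integral_of_summable_integral_norm hS_i
      (by simp_rw [hSn]; exact hsum.mul_right _)
    rwa [funext Q.integral_alive_mul_S] at this
  have hES : ∫ ω, ∑' k, alive (y ω) k * S k ω ∂Pr = (∑' k, A k) * (1 / r) := by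
    rw [← hsumS.tsum_eq, tsum_mul_right]
  have hEK : 1 ≤ ∑' k, A k := by
    rw [← hA0]; exact hsum.le_tsum 0 fun k _ => hAnn k
  have hint : Integrable (fun ω => ∑' k, alive (y ω) k * S k ω) Pr := by
    refine Integrable.of_integral_ne_zero ?_
    rw [hES]
    positivity
  -- the backlog at the end of an incomplete cycle is negligible in the mean
  have hR0 : Tendsto R atTop (𝓝 0) := by
    have : Tendsto R atTop (𝓝 (∫ ω, (0 : ℝ) ∂Pr)) := by
      refine tendsto_integral_of_dominated_convergence
        (fun ω => wake ω + ∑' k, alive (y ω) k * S k ω) (fun N => ?_)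
        (Q.integrable_wakeUp.add hint) (fun N => ?_) ?_
      · exact ((Q.measurable_alive (N + 1)).mul
          (Q.measurable_excess (N + 1)).neg).aestronglyMeasurable
      · filter_upwards [Q.ae_nonneg, Q.ae_findsEmpty_nonempty hn] with ω hω hne
        have h0 : 0 ≤ y ω 0 := by simp only [y, excess_zero]; exact hω.1 0
        have hw : 0 ≤ wake ω := wakeUp_nonneg (fun i hi => hω.2.2 i hi 0) _
        have h1 := alive_mul_neg_excess_le Q.tau_nonneg Q.tau_mono (y := y ω) (fun k => rfl) hω.1 h0
          N hw hω.2.1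
        obtain ⟨K, hK, hK'⟩ := hne
        rw [← sub_nonneg, arrival_sub_cleared] at hK'
        have hs : Summable fun k => alive (y ω) k * S k ω :=
          summable_of_ne_finset_zero (s := Finset.range K) fun k hk => by
            rw [alive_eq_zero hK (not_lt.1 fun h => hk (Finset.mem_range.2 h)) hK', zero_mul]
        have h2 : ∑ k ∈ Finset.range (N + 1), alive (y ω) k * S k ω ≤
            ∑' k, alive (y ω) k * S k ω :=
          hs.sum_le_tsum _ fun k _ => mul_nonneg (alive_nonneg _ _) (hω.2.1 k)
        have h3 : 0 ≤ alive (y ω) (N + 1) * (-y ω (N + 1)) := by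
          rcases lt_or_ge (y ω (N + 1)) 0 with h | h
          · exact mul_nonneg (alive_nonneg _ _) (by linarith)
          · rw [alive_eq_zero (y := y ω) (by omega) le_rfl h, zero_mul]
        rw [Real.norm_of_nonneg h3]
        simp only [wake] at *
        linarith
      · filter_upwards [Q.ae_findsEmpty_nonempty hn] with ω hne
        obtain ⟨K, hK, hK'⟩ := hne
        rw [← sub_nonneg, arrival_sub_cleared] at hK'
        refine tendsto_const_nhds.congr' ?_
        filter_upwards [eventually_ge_atTop K] with N hN
        rw [alive_eq_zero hK (by omega) hK', zero_mul]
    simpa using this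
  have hEKeq : (1 / lam - 1 / r) * ∑' k, A k = V + 1 / lam := by
    have h1 := ((tendsto_add_atTop_iff_nat 1).2 hsum.hasSum.tendsto_sum_nat).const_mul
      (1 / lam - 1 / r)
    have h2 : Tendsto (fun N => V + 1 / lam * (1 - A (N + 1)) - R N) atTop
        (𝓝 (V + 1 / lam * (1 - 0) - 0)) :=
      ((((tendsto_add_atTop_iff_nat 1).2 hsum.tendsto_atTop_zero).const_sub 1).const_mul
        (1 / lam) |>.const_add V).sub hR0
    simp_rw [hbal] at h1
    have := tendsto_nhds_unique h1 h2
    linarith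
  have hcycle : (fun ω => cycleLength n τ (fun k => X k ω) (fun k => S k ω) (fun i k => W i k ω))
      =ᵐ[Pr] fun ω => X 0 ω + wake ω + ∑' k, alive (y ω) k * S k ω := by
    filter_upwards [Q.ae_nonneg, Q.ae_findsEmpty_nonempty hn] with ω hω hne
    have h0 : 0 ≤ y ω 0 := by simp only [y, excess_zero]; exact hω.1 0
    rw [cycleLength_eq Q.tau_nonneg Q.tau_mono (y := y ω) (fun k => rfl) h0 hne]
    simp only [y, wake, excess_zero]
  have hXw : Integrable (fun ω => X 0 ω + wake ω) Pr := (Q.integrable_X 0).add Q.integrable_wakeUp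
  refine ⟨(hXw.add hint).congr hcycle.symm, ?_⟩
  rw [integral_congr_ae hcycle, integral_add hXw hint,
    integral_add (Q.integrable_X 0) Q.integrable_wakeUp, hES, Q.integral_X]
  rw [Q.integral_wakeUp hn]
  have hEK2 : ∑' k, A k = (V + 1 / lam) / (1 / lam - 1 / r) := by
    rw [eq_div_iff hdrift.ne']; linarith
  rw [hEK2]
  change 1 / lam + V + (V + 1 / lam) / (1 / lam - 1 / r) * (1 / r) =
    1 / lam * ((1 / lam + V) / (1 / lam - 1 / r))
  rw [← sub_eq_zero]
  have : 1 / lam + V + (V + 1 / lam) / (1 / lam - 1 / r) * (1 / r)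
      - 1 / lam * ((1 / lam + V) / (1 / lam - 1 / r)) =
      (1 / lam + V) * (1 - (1 / lam - 1 / r) / (1 / lam - 1 / r)) := by ring
  rw [this, div_self hdrift.ne', sub_self, mul_zero]

end IsSleepQueue

end SleepServer

theorem mainTheorem1 {Ω : Type*} [MeasurableSpace Ω] (Pr : Measure Ω) [IsProbabilityMeasure Pr]
    -- arrival rate, maximal service rate, frequency factor; stability
    (lam mu f : ℝ) (hlam : 0 < lam) (hmu : 0 < mu) (hstab : lam < mu * f)
    -- `n` low-power states, with indices `1, …, n`; index `0` is the active state
    (n : ℕ) (hn : 1 ≤ n) (P τ w : ℕ → ℝ)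
    (hτ_nonneg : 0 ≤ τ 1) (hτ : StrictMonoOn τ (Set.Icc 1 n))
    -- the law of the wake-up latency from state `i`, with mean `w i`
    (ν : ℕ → Measure ℝ)
    (hν_nonneg : ∀ i ∈ Finset.Icc 1 n, ∀ᵐ x ∂ν i, 0 ≤ x)
    (hν_int : ∀ i ∈ Finset.Icc 1 n, Integrable (fun x : ℝ => x) (ν i))
    (hν_mean : ∀ i ∈ Finset.Icc 1 n, ∫ x, x ∂ν i = w i)
    -- inter-arrival times, service times, wake-up latencies
    (X S : ℕ → Ω → ℝ) (W : ℕ → ℕ → Ω → ℝ)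
    (hX_meas : ∀ k, Measurable (X k)) (hS_meas : ∀ k, Measurable (S k))
    (hW_meas : ∀ i ∈ Finset.Icc 1 n, ∀ k, Measurable (W i k))
    (hX_law : ∀ k, Pr.map (X k) = expMeasure lam)
    (hS_law : ∀ k, Pr.map (S k) = expMeasure (mu * f))
    (hW_law : ∀ i ∈ Finset.Icc 1 n, ∀ k, Pr.map (W i k) = ν i)
    (h_indep : iIndepFun
      (Sum.elim X (Sum.elim S (fun p : Finset.Icc 1 n × ℕ => W p.1 p.2))) Pr) :
    -- the cycle that starts at time `0` ends almost surely, and its mean length is `L`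
    ((∀ᵐ ω ∂Pr, (SleepServer.findsEmpty n τ (fun k => X k ω) (fun k => S k ω)
        (fun i k => W i k ω)).Nonempty) ∧
      Integrable (fun ω => SleepServer.cycleLength n τ (fun k => X k ω) (fun k => S k ω)
        (fun i k => W i k ω)) Pr ∧
      ∫ ω, SleepServer.cycleLength n τ (fun k => X k ω) (fun k => S k ω)
        (fun i k => W i k ω) ∂Pr = SleepServer.closedL lam mu f n τ w) ∧
    -- almost surely, the power averaged over `[0, T]` converges to the closed form
    (∀ᵐ ω ∂Pr,
      (∀ T : ℝ, 0 ≤ T → IntervalIntegrable (SleepServer.power n P τ (fun k => X k ω)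
        (fun k => S k ω) (fun i k => W i k ω)) volume 0 T) ∧
      Tendsto (fun T : ℝ => (∫ t in (0 : ℝ)..T, SleepServer.power n P τ (fun k => X k ω)
        (fun k => S k ω) (fun i k => W i k ω) t) / T) atTop
        (𝓝 (SleepServer.closedPower lam mu f n P τ w))) ∧
    -- and so does its expectation
    ((∀ T : ℝ, 0 ≤ T → Integrable (fun ω => ∫ t in (0 : ℝ)..T, SleepServer.power n P τ
        (fun k => X k ω) (fun k => S k ω) (fun i k => W i k ω) t) Pr) ∧
      Tendsto (fun T : ℝ => ∫ ω, (∫ t in (0 : ℝ)..T, SleepServer.power n P τ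
        (fun k => X k ω) (fun k => S k ω) (fun i k => W i k ω) t) / T ∂Pr) atTop
        (𝓝 (SleepServer.closedPower lam mu f n P τ w))) := by
  have hr : 0 < mu * f := hlam.trans hstab
  have Q : SleepServer.IsSleepQueue Pr lam (mu * f) n τ w X S W :=
    { lam_pos := hlam
      stable := hstab
      tau_nonneg := hτ_nonneg
      tau_mono := hτ
      X_meas := hX_meas
      S_meas := hS_meas
      W_meas := hW_meas
      X_law := hX_law
      S_law := hS_law
      W_nonneg := fun i hi k => ae_of_ae_map (hW_meas i hi k).aemeasurable (by
        rw [hW_law i hi]; exact hν_nonneg i hi)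
      W_int := fun i hi => by
        have h : Integrable (fun x : ℝ => x) (Pr.map (W i 0)) := by
          rw [hW_law i hi]; exact hν_int i hi
        exact h.comp_measurable (hW_meas i hi 0)
      W_mean := fun i hi => by
        rw [← hν_mean i hi, ← hW_law i hi 0,
          integral_map (hW_meas i hi 0).aemeasurable (by fun_prop)]
      W_ident := fun i hi k => ⟨(hW_meas i hi k).aemeasurable, (hW_meas i hi 0).aemeasurable, by
        rw [hW_law i hi, hW_law i hi]⟩
      indep := h_indep }
  have hV := Q.stateSum_nonneg hn
  have hdiff : 0 < mu * f - lam := sub_pos.2 hstab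
  set V := SleepServer.stateSum lam n τ w with hVdef
  -- the closed forms in terms of the rates per job
  have hL : SleepServer.closedL lam mu f n τ w =
      1 / lam * ((1 / lam + V) / (1 / lam - 1 / (mu * f))) := by
    have h1 : 1 / lam - 1 / (mu * f) = (mu * f - lam) / (lam * (mu * f)) := by
      rw [div_sub_div _ _ hlam.ne' hr.ne']; ring
    rw [SleepServer.closedL, ← hVdef, h1]
    generalize mu * f = r at *
    field_simp
  have hxV : 0 < 1 / lam + V := by positivity
  have hd : 0 < 1 / lam - 1 / (mu * f) := sub_pos.2 (one_div_lt_one_div_of_lt hlam hstab)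
  have hP : SleepServer.closedPower lam mu f n P τ w =
      P 0 + (SleepServer.stateSum lam n τ P - P 0 * Real.exp (-lam * τ 1)) / lam *
        ((1 / lam - 1 / (mu * f)) / (1 / lam + V)) / (1 / lam) := by
    rw [SleepServer.closedPower, hL]
    generalize 1 / lam - 1 / (mu * f) = d at *
    generalize 1 / lam + V = e at *
    field_simp
    ring
  set K := ∑ i ∈ Finset.range (n + 1), |P i|
  -- the power is bounded and jointly measurable in the sample point and the time
  have hjoint : Measurable fun p : Ω × ℝ => SleepServer.power n P τ (fun k => X k p.1)
      (fun k => S k p.1) (fun i k => W i k p.1) p.2 :=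
    SleepServer.measurable_power hτ_nonneg hτ P (X := fun k p => X k p.1)
      (S := fun k p => S k p.1) (W := fun i k p => W i k p.1) measurable_snd
      (fun k => (hX_meas k).comp (f := Prod.fst) measurable_fst)
      (fun k => (hS_meas k).comp (f := Prod.fst) measurable_fst)
      (fun i hi k => (hW_meas i hi k).comp (f := Prod.fst) measurable_fst)
  have hintt : ∀ ω T, IntervalIntegrable (SleepServer.power n P τ (fun k => X k ω)
      (fun k => S k ω) (fun i k => W i k ω)) volume 0 T := fun ω T =>
    (intervalIntegrable_const (c := K)).mono_fun'
      (hjoint.comp measurable_prodMk_left).aestronglyMeasurable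
      (Eventually.of_forall fun t => SleepServer.abs_power_le P t)
  have hmeasT : ∀ T : ℝ, 0 ≤ T → StronglyMeasurable fun ω => ∫ t in (0 : ℝ)..T,
      SleepServer.power n P τ (fun k => X k ω) (fun k => S k ω) (fun i k => W i k ω) t := by
    intro T hT
    simp_rw [intervalIntegral.integral_of_le hT]
    exact hjoint.stronglyMeasurable.integral_prod_right'
  have hbound : ∀ T : ℝ, 0 ≤ T → ∀ ω, ‖∫ t in (0 : ℝ)..T,
      SleepServer.power n P τ (fun k => X k ω) (fun k => S k ω) (fun i k => W i k ω) t‖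
        ≤ K * T := by
    intro T hT ω
    have := intervalIntegral.norm_integral_le_of_norm_le_const (a := 0) (b := T) (C := K)
      (f := SleepServer.power n P τ (fun k => X k ω) (fun k => S k ω) (fun i k => W i k ω))
      fun t _ => SleepServer.abs_power_le P t
    rwa [sub_zero, abs_of_nonneg hT] at this
  have hlim : ∀ᵐ ω ∂Pr, Tendsto (fun T : ℝ => (∫ t in (0 : ℝ)..T, SleepServer.power n P τ
      (fun k => X k ω) (fun k => S k ω) (fun i k => W i k ω) t) / T) atTop
      (𝓝 (SleepServer.closedPower lam mu f n P τ w)) := by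
    filter_upwards [Q.ae_nonneg, Q.ae_limits hn P] with ω hω hl
    rw [hP]
    exact SleepServer.tendsto_average_power hτ_nonneg hτ hω.2.1 hω.2.2 P (by positivity) hl.1 hl.2.2
  refine ⟨⟨Q.ae_findsEmpty_nonempty hn, (Q.integral_cycleLength hn).1, ?_⟩, ?_, ?_, ?_⟩
  · rw [(Q.integral_cycleLength hn).2, hL]
  · filter_upwards [hlim] with ω hω
    exact ⟨fun T _ => hintt ω T, hω⟩
  · exact fun T hT => Integrable.of_bound (hmeasT T hT).aestronglyMeasurable (K * T)
      (Eventually.of_forall (hbound T hT))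
  · have h := tendsto_integral_filter_of_norm_le_const (μ := Pr) (l := atTop)
      (F := fun T ω => (∫ t in (0 : ℝ)..T, SleepServer.power n P τ
        (fun k => X k ω) (fun k => S k ω) (fun i k => W i k ω) t) / T)
      (f := fun _ => SleepServer.closedPower lam mu f n P τ w)
      ((eventually_ge_atTop 0).mono fun T hT =>
        ((hmeasT T hT).measurable.div_const T).aestronglyMeasurable)
      ⟨K, (eventually_gt_atTop 0).mono fun T hT => Eventually.of_forall fun ω => by
        rw [norm_div, Real.norm_of_nonneg hT.le, div_le_iff₀ hT]
        exact hbound T hT.le ω⟩ hlim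
    simpa using h
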